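/- Let $n\ge 0$ and let $D=(d_1,\dots,d_n)$ with $d_1\le\dots\le d_n$ be positive integers; put $M=\sum_i d_i$. Call $D$ a strict graphic sequence if $\sum_{i=n-k+1}^n d_i<k(k-1)+\sum_{i=1}^{n-k}\min\{k,d_i\}$ for all $1\le k\le n$, and, for $\varepsilon>0$, a strict graphic sequence of type $\varepsilon$ if moreover $M$ is even and $n^{1+\varepsilon}\le M$. Let $\mathbb G^D$ be the set of simple graphs on $\{1,\dots,n\}$ in which vertex $i$ has degree $d_i$ for every $i$. Let $\widetilde{\mathbf p}=(\widetilde p_{ij})$ be the point at which $H_1(x)=\sum_{i<j}\bigl(-x_{ij}\log x_{ij}-(1-x_{ij})\log(1-x_{ij})\bigr)$ attains its maximum over all symmetric $x=(x_{ij})_{i\ne j}$ with $0\le x_{ij}\le 1$ and $\sum_{j\ne i}x_{ij}=d_i$ for all $i$, and let $\widetilde{\mathcal G}(D)$ be the random graph on $\{1,\dots,n\}$ whose edges $\langle i,j\rangle$ are present independently with probabilities $\widetilde p_{ij}$. Let $\mathcal G_{\mathbf g}(D)$ be uniform on $\mathbb G^D$. For a tree $T$ on the vertex set $\{1,\dots,k\}$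 with degrees $b_u$ and an injection $s:\{1,\dots,k\}\to\{1,\dots,n\}$ let $\psi(s,T,D)=\prod_u d_{s(u)}^{\,b_u-1}$, and let $\mathbf p_{\mathbf g}(s,T)$ and $\widetilde{\mathbf p}(s,T)$ be the probabilities that $s$ maps every edge of $T$ to an edge of $\mathcal G_{\mathbf g}(D)$, respectively of $\widetilde{\mathcal G}(D)$. Put $$L_{\mathbf g}(k,D)=\frac1M\sum_{(s,T)}\frac1{\psi(s,T,D)}\bigl|\mathbf p_{\mathbf g}(s,T)-\widetilde{\mathbf p}(s,T)\bigr|,$$ the sum being over all such pairs $(s,T)$. Then: (1) If $D$ is a strict graphic sequence and $\mathbb G^D\neq\emptyset$, then $P(\widetilde{\mathcal G}(D)\in\mathbb G^D)>0$, and $\widetilde{\mathcal G}(D)$ conditioned on $\widetilde{\mathcal G}(D)\in\mathbb G^D$ is uniform on $\mathbb G^D$. (2) For every $k$ and every $\eta>0$ there is a constant $c>0$, depending only on $k$ and $\eta$, such that for every $\varepsilon>0$, every $n$ and every strict graphic sequence $D$ of type $\varepsilon$ and length $n$: if $P(\widetilde{\mathcal G}(D)\in\mathbb G^D)\ge e^{-\eta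 n\log n}$, then $$L_{\mathbf g}(k,D)\le c\,\sqrt{\frac{n\log n}{M}}.$$ (3) Consequently, for every $\varepsilon>0$: if there is $\eta>0$ such that $e^{-\eta n\log n}e^{H_1(\widetilde{\mathbf p})}\le|\mathbb G^D|\le e^{H_1(\widetilde{\mathbf p})}$ for all $n$ and all strict graphic sequences $D$ of type $\varepsilon$ and length $n$, then for every $k$ there is $c_k>0$ such that $L_{\mathbf g}(k,D)\le c_k\sqrt{n\log n/M}$ for all $n$ and all strict graphic sequences $D$ of type $\varepsilon$ and length $n$. -/

import Mathlib

noncomputable section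

open scoped Classical

namespace DegSeq

/-- `M = d₁ + ⋯ + dₙ`. -/
def total {n : ℕ} (D : Fin n → ℕ) : ℕ := ∑ i, D i

/-- The strict Erdős–Gallai conditions for a sequence `d₁ ≤ ⋯ ≤ dₙ` (indexed from `0` in `Fin n`): for `1 ≤ k ≤ n` the sum of the `k` largest degrees is less than
`k (k - 1)` plus the sum of `min k dᵢ` over the other indices. -/
def StrictErdosGallai {n : ℕ} (D : Fin n → ℕ) : Prop :=
  ∀ k : ℕ, 1 ≤ k → k ≤ n →
    ∑ i : Fin n with n - k ≤ i.val, D i <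
      k * (k - 1) + ∑ i : Fin n with i.val < n - k, min k (D i)

/-- Strict graphic sequences: nondecreasing, positive, strict Erdős–Gallai. -/
structure IsStrictGraphic {n : ℕ} (D : Fin n → ℕ) : Prop where
  mono : Monotone D
  pos : ∀ i, 0 < D i
  strictEG : StrictErdosGallai D

/-- Strict graphic sequences of type `ε`: moreover `M` is even and `n ^ (1 + ε) ≤ M`. -/
structure IsStrictGraphicOfType {n : ℕ} (ε : ℝ) (D : Fin n → ℕ) : Prop
    extends IsStrictGraphic D where
  even_total : Even (total D)
  le_total : (n : ℝ) ^ (1 + ε) ≤ (total D : ℝ)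

/-- The polytope of the `x = (x_{ij})_{i ≠ j}` with `x_{ij} = x_{ji} ∈ [0, 1]` and
`∑_{j ≠ i} x_{ij} = dᵢ`; the unused diagonal entries are set to `0`. -/
structure IsInPolytope {n : ℕ} (D : Fin n → ℕ) (x : Fin n → Fin n → ℝ) : Prop where
  symm : ∀ i j, x i j = x j i
  diag : ∀ i, x i i = 0
  nonneg : ∀ i j, 0 ≤ x i j
  le_one : ∀ i j, x i j ≤ 1
  row_sum : ∀ i, ∑ j, x i j = (D i : ℝ)

/-- `H₁(x) = ∑_{i < j} H(x_{ij})` with `H(t) = - t log t - (1 - t) log (1 - t)`. -/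
def entropy {n : ℕ} (x : Fin n → Fin n → ℝ) : ℝ :=
  ∑ e : Fin n × Fin n with e.1 < e.2, Real.binEntropy (x e.1 e.2)

/-- `p` is the point of the polytope at which the entropy takes its maximum. -/
def IsMaxEntropy {n : ℕ} (D : Fin n → ℕ) (p : Fin n → Fin n → ℝ) : Prop :=
  IsInPolytope D p ∧ ∀ x, IsInPolytope D x → entropy x ≤ entropy p

/-- The set of simple graphs on `n` labelled vertices in which vertex `i` has degree `dᵢ`. -/
def graphs {n : ℕ} (D : Fin n → ℕ) : Finset (SimpleGraph (Fin n)) :=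
  {G | ∀ i, G.degree i = D i}

/-- The probability that the random graph with independent edges, the edge `⟨i, j⟩` being present
with probability `p i j`, equals `G`. -/
def bernoulliMass {n : ℕ} (p : Fin n → Fin n → ℝ) (G : SimpleGraph (Fin n)) : ℝ :=
  ∏ e : Fin n × Fin n with e.1 < e.2, if G.Adj e.1 e.2 then p e.1 e.2 else 1 - p e.1 e.2

/-- The probability that the independent-edge random graph lies in `S`. -/
def bernoulliProb {n : ℕ} (p : Fin n → Fin n → ℝ) (S : Finset (SimpleGraph (Fin n))) : ℝ :=
  ∑ G ∈ S, bernoulliMass p G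

/-- The indicator `1_s(T, G)`: every edge of `T` is mapped by `s` to an edge of `G`. -/
def treeIndicator {k n : ℕ} (s : Fin k ↪ Fin n) (T : SimpleGraph (Fin k))
    (G : SimpleGraph (Fin n)) : ℝ :=
  if ∀ u v, T.Adj u v → G.Adj (s u) (s v) then 1 else 0

/-- The expectation of `1_s(T, ·)` for the independent-edge random graph. -/
def treeProbBernoulli {k n : ℕ} (p : Fin n → Fin n → ℝ) (s : Fin k ↪ Fin n)
    (T : SimpleGraph (Fin k)) : ℝ :=
  ∑ G : SimpleGraph (Fin n), bernoulliMass p G * treeIndicator s T G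

/-- The expectation of `1_s(T, ·)` for the uniform random graph with degree sequence `D`. -/
def treeProbUniform {k n : ℕ} (D : Fin n → ℕ) (s : Fin k ↪ Fin n)
    (T : SimpleGraph (Fin k)) : ℝ :=
  (∑ G ∈ graphs D, treeIndicator s T G) / ((graphs D).card : ℝ)

/-- The `B`-function `∏_u d_{s(u)} ^ (b_u - 1)`, where `b_u` is the degree of `u` in `T`. -/
def bFunction {k n : ℕ} (D : Fin n → ℕ) (s : Fin k ↪ Fin n) (T : SimpleGraph (Fin k)) : ℝ :=
  ∏ u, (D (s u) : ℝ) ^ ((T.degree u : ℤ) - 1)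

/-- The discrepancy `L_g(k, D)`, a sum over all pairs of an injection `s : [k] → [n]` and a tree
`T` on the vertex set `[k]`. -/
def discrepancy {n : ℕ} (k : ℕ) (D : Fin n → ℕ) (p : Fin n → Fin n → ℝ) : ℝ :=
  1 / (total D : ℝ) *
    ∑ s : Fin k ↪ Fin n, ∑ T : SimpleGraph (Fin k) with T.IsTree,
      1 / bFunction D s T * |treeProbUniform D s T - treeProbBernoulli p s T|

/-- The conjectured two-sided bound on the number of graphs with degree sequence `D`, for
sequences of type `ε`. -/
def LowerBoundConjecture (ε : ℝ) : Prop :=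
  ∃ η : ℝ, 0 < η ∧ ∀ (n : ℕ) (D : Fin n → ℕ) (p : Fin n → Fin n → ℝ),
    IsStrictGraphicOfType ε D → IsMaxEntropy D p →
      Real.exp (-η * n * Real.log n) * Real.exp (entropy p) ≤ ((graphs D).card : ℝ) ∧
        ((graphs D).card : ℝ) ≤ Real.exp (entropy p)

/-- The conjectured bound on the discrepancy, for sequences of type `ε`. -/
def DiscrepancyConjecture (ε : ℝ) : Prop :=
  ∀ k : ℕ, ∃ c : ℝ, 0 < c ∧ ∀ (n : ℕ) (D : Fin n → ℕ) (p : Fin n → Fin n → ℝ),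
    IsStrictGraphicOfType ε D → IsMaxEntropy D p →
      discrepancy k D p ≤ c * Real.sqrt (n * Real.log n / total D)

end DegSeq

end

noncomputable section

open scoped Classical

namespace DegSeq

/-! ### Erdős–Gallai inequalities for arbitrary vertex sets -/

theorem card_filter_le_val {n k : ℕ} (hk : k ≤ n) :
    (Finset.univ.filter fun i : Fin n => n - k ≤ i.val).card = k := by
  rcases Nat.eq_zero_or_pos k with rfl | hk0
  · simp only [Finset.card_eq_zero, Finset.filter_eq_empty_iff]
    intro i _
    have := i.2
    omega
  · have h := Fin.card_Ici (⟨n - k, by omega⟩ : Fin n)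
    have h2 : (Finset.univ.filter fun i : Fin n => n - k ≤ i.val)
        = Finset.Ici (⟨n - k, by omega⟩ : Fin n) := by
      ext i
      simp [Fin.le_def]
    rw [h2, h]
    simp
    omega

/-- Among all sets of `k` indices, the last `k` have the largest sum of a monotone function. -/
theorem sum_le_sum_last {n : ℕ} {g : Fin n → ℕ} (hg : Monotone g) (F : Finset (Fin n)) :
    ∑ i ∈ F, g i ≤ ∑ i : Fin n with n - F.card ≤ i.val, g i := by
  have hk : F.card ≤ n := by simpa using F.card_le_univ
  set T := Finset.univ.filter fun i : Fin n => n - F.card ≤ i.val with hT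
  have hcard : T.card = F.card := card_filter_le_val hk
  rcases Finset.eq_empty_or_nonempty F with rfl | hne
  · simp
  have hpos : 0 < F.card := hne.card_pos
  have hcard' : (F \ T).card = (T \ F).card := by
    have h1 := Finset.card_sdiff_add_card_inter F T
    have h2 := Finset.card_sdiff_add_card_inter T F
    rw [Finset.inter_comm T F] at h2
    omega
  let m : Fin n := ⟨n - F.card, by omega⟩
  have h1 : ∑ i ∈ F \ T, g i ≤ (F \ T).card • g m := by
    refine Finset.sum_le_card_nsmul _ _ _ fun i hi => hg ?_
    simp only [hT, Finset.mem_sdiff, Finset.mem_filter, Finset.mem_univ, true_and, not_le] at hi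
    exact Fin.le_def.2 hi.2.le
  have h2 : (T \ F).card • g m ≤ ∑ i ∈ T \ F, g i := by
    refine Finset.card_nsmul_le_sum _ _ _ fun i hi => hg ?_
    simp only [hT, Finset.mem_sdiff, Finset.mem_filter, Finset.mem_univ, true_and] at hi
    exact Fin.le_def.2 hi.1
  have h3 := Finset.sum_inter_add_sum_sdiff F T g
  have h4 := Finset.sum_inter_add_sum_sdiff T F g
  rw [Finset.inter_comm T F] at h4
  rw [hcard'] at h1
  omega

theorem IsStrictGraphic.sum_lt {n : ℕ} {D : Fin n → ℕ} (hD : IsStrictGraphic D)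
    {F : Finset (Fin n)} (hF : F.Nonempty) :
    ∑ i ∈ F, D i < F.card * (F.card - 1) + ∑ i ∈ Fᶜ, min F.card (D i) := by
  have hk : F.card ≤ n := by simpa using F.card_le_univ
  have hEG := hD.strictEG F.card hF.card_pos hk
  have hmono : Monotone fun i => D i + min F.card (D i) := fun i j hij => by
    have := hD.mono hij
    dsimp only
    omega
  have h1 := sum_le_sum_last hmono F
  simp only [Finset.sum_add_distrib] at h1
  have h2 := Finset.sum_add_sum_compl F fun i => min F.card (D i)
  have h3 := Finset.sum_filter_add_sum_filter_not Finset.univ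
    (fun i : Fin n => n - F.card ≤ i.val) fun i => min F.card (D i)
  simp only [not_le] at h3
  omega

/-! ### Feasible directions at a point of the polytope -/

/-- The directions in which one can move from `p` while keeping all entries in `[0, 1]`. -/
structure IsFeasibleDir {n : ℕ} (p δ : Fin n → Fin n → ℝ) : Prop where
  symm : ∀ i j, δ i j = δ j i
  diag : ∀ i, δ i i = 0
  nonneg : ∀ i j, p i j = 0 → 0 ≤ δ i j
  nonpos : ∀ i j, p i j = 1 → δ i j ≤ 0

/-- The row sums of feasible directions. -/
def IsFeasibleRowSum {n : ℕ} (p : Fin n → Fin n → ℝ) (y : Fin n → ℝ) : Prop :=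
  ∃ δ, IsFeasibleDir p δ ∧ ∀ i, ∑ j, δ i j = y i

theorem IsFeasibleRowSum.add {n : ℕ} {p : Fin n → Fin n → ℝ} {y z : Fin n → ℝ}
    (hy : IsFeasibleRowSum p y) (hz : IsFeasibleRowSum p z) : IsFeasibleRowSum p (y + z) := by
  obtain ⟨δ, hδ, hδy⟩ := hy
  obtain ⟨γ, hγ, hγz⟩ := hz
  refine ⟨δ + γ, ⟨fun i j => ?_, fun i => ?_, fun i j h => ?_, fun i j h => ?_⟩, fun i => ?_⟩
  · simp [hδ.symm i j, hγ.symm i j]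
  · simp [hδ.diag, hγ.diag]
  · exact add_nonneg (hδ.nonneg i j h) (hγ.nonneg i j h)
  · exact add_nonpos (hδ.nonpos i j h) (hγ.nonpos i j h)
  · simp [Finset.sum_add_distrib, hδy, hγz]

theorem IsFeasibleRowSum.smul {n : ℕ} {p : Fin n → Fin n → ℝ} {y : Fin n → ℝ}
    (hy : IsFeasibleRowSum p y) {c : ℝ} (hc : 0 ≤ c) : IsFeasibleRowSum p (c • y) := by
  obtain ⟨δ, hδ, hδy⟩ := hy
  refine ⟨fun i j => c * δ i j, ⟨fun i j => ?_, fun i => ?_, fun i j h => ?_, fun i j h => ?_⟩,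
    fun i => ?_⟩
  · rw [hδ.symm i j]
  · rw [hδ.diag, mul_zero]
  · exact mul_nonneg hc (hδ.nonneg i j h)
  · exact mul_nonpos_of_nonneg_of_nonpos hc (hδ.nonpos i j h)
  · simp [← Finset.mul_sum, hδy]

/-- The direction that changes the single edge `ab` by `c`. -/
def edgeDir {n : ℕ} (a b : Fin n) (c : ℝ) (i j : Fin n) : ℝ :=
  if (i = a ∧ j = b) ∨ (i = b ∧ j = a) then c else 0

theorem edgeDir_symm {n : ℕ} (a b : Fin n) (c : ℝ) (i j : Fin n) :
    edgeDir a b c i j = edgeDir a b c j i := by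
  unfold edgeDir
  congr 1
  grind

theorem edgeDir_diag {n : ℕ} {a b : Fin n} (hab : a ≠ b) (c : ℝ) (i : Fin n) :
    edgeDir a b c i i = 0 := by
  unfold edgeDir
  grind

theorem sum_edgeDir {n : ℕ} {a b : Fin n} (hab : a ≠ b) (c : ℝ) (i : Fin n) :
    ∑ j, edgeDir a b c i j = c * (Pi.single a (1 : ℝ) + Pi.single b 1 : Fin n → ℝ) i := by
  by_cases ha : i = a
  · subst ha
    simp [edgeDir, hab]
  · by_cases hb : i = b
    · subst hb
      simp [edgeDir, hab.symm]
    · simp [edgeDir, ha, hb]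

theorem IsFeasibleDir.edge {n : ℕ} {p : Fin n → Fin n → ℝ} (hp : ∀ i j, p i j = p j i)
    {a b : Fin n} (hab : a ≠ b) {c : ℝ} (h0 : p a b = 0 → 0 ≤ c) (h1 : p a b = 1 → c ≤ 0) :
    IsFeasibleDir p (edgeDir a b c) := by
  refine ⟨edgeDir_symm a b c, edgeDir_diag hab c, fun i j h => ?_, fun i j h => ?_⟩
  · unfold edgeDir
    split_ifs with hij
    · rcases hij with ⟨rfl, rfl⟩ | ⟨rfl, rfl⟩
      · exact h0 h
      · exact h0 (hp _ _ ▸ h)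
    · exact le_rfl
  · unfold edgeDir
    split_ifs with hij
    · rcases hij with ⟨rfl, rfl⟩ | ⟨rfl, rfl⟩
      · exact h1 h
      · exact h1 (hp _ _ ▸ h)
    · exact le_rfl

theorem IsFeasibleRowSum.edge {n : ℕ} {p : Fin n → Fin n → ℝ} (hp : ∀ i j, p i j = p j i)
    {a b : Fin n} (hab : a ≠ b) {c : ℝ} (h0 : p a b = 0 → 0 ≤ c) (h1 : p a b = 1 → c ≤ 0) :
    IsFeasibleRowSum p (c • (Pi.single a (1 : ℝ) + Pi.single b 1)) :=
  ⟨_, IsFeasibleDir.edge hp hab h0 h1, fun i => by simpa using sum_edgeDir hab c i⟩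

/-- Under the strict Erdős–Gallai conditions every vertex can be charged in either direction. -/
theorem IsStrictGraphic.isFeasibleRowSum_single {n : ℕ} {D : Fin n → ℕ}
    (hD : IsStrictGraphic D) {p : Fin n → Fin n → ℝ} (hp : IsInPolytope D p) (a : Fin n)
    {σ : ℝ} (hσ : σ = 1 ∨ σ = -1) : IsFeasibleRowSum p (Pi.single a (2 * σ)) := by
  by_contra hcon
  let E := Finset.univ.filter fun v => IsFeasibleRowSum p (Pi.single a σ + Pi.single v 1)
  let F := Finset.univ.filter fun v => IsFeasibleRowSum p (Pi.single a σ - Pi.single v 1)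
  have hE : ∀ v, v ∈ E ↔ IsFeasibleRowSum p (Pi.single a σ + Pi.single v 1) := by simp [E]
  have hF : ∀ v, v ∈ F ↔ IsFeasibleRowSum p (Pi.single a σ - Pi.single v 1) := by simp [F]
  have hdisj : ∀ v, v ∈ E → v ∉ F := fun v h1 h2 => hcon <| by
    have := ((hE v).1 h1).add ((hF v).1 h2)
    convert this using 1
    rw [two_mul, Pi.single_add]
    abel
  have hEF : ∀ v ∈ E, ∀ w, v ≠ w → p v w ≠ 0 → w ∈ F := fun v hv w hvw hpw => (hF w).2 <| by
    have h2 := IsFeasibleRowSum.edge (c := -1) hp.symm hvw (fun h => absurd h hpw)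
      (fun _ => by norm_num)
    convert ((hE v).1 hv).add h2 using 1
    simp
    abel
  have hFE : ∀ v ∈ F, ∀ w, v ≠ w → p v w ≠ 1 → w ∈ E := fun v hv w hvw hpw => (hE w).2 <| by
    have h2 := IsFeasibleRowSum.edge (c := 1) hp.symm hvw (fun _ => by norm_num)
      (fun h => absurd h hpw)
    convert ((hF v).1 hv).add h2 using 1
    simp
    abel
  have hzero : IsFeasibleRowSum p 0 :=
    ⟨0, ⟨fun _ _ => rfl, fun _ => rfl, fun _ _ _ => le_rfl, fun _ _ _ => le_rfl⟩, by simp⟩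
  have hne : F.Nonempty := by
    rcases hσ with rfl | rfl
    · exact ⟨a, (hF a).2 (by simpa using hzero)⟩
    · have haE : a ∈ E := (hE a).2 (by
        convert hzero using 1
        rw [Pi.single_neg]
        simp)
      have hpos : (0 : ℝ) < ∑ j, p a j := by
        rw [hp.row_sum]
        exact_mod_cast hD.pos a
      obtain ⟨w, -, hw⟩ := Finset.exists_ne_zero_of_sum_ne_zero hpos.ne'
      refine ⟨w, hEF a haE w ?_ hw⟩
      rintro rfl
      exact hw (hp.diag _)
  have hcol : ∀ j, ∑ i ∈ F, p j i
      = if j ∈ F then ((F.card - 1 : ℕ) : ℝ) else ((min F.card (D j) : ℕ) : ℝ) := by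
    intro j
    have hle : ∑ i ∈ F, p j i ≤ (D j : ℝ) := by
      rw [← hp.row_sum j]
      exact Finset.sum_le_sum_of_subset_of_nonneg (Finset.subset_univ _)
        fun i _ _ => hp.nonneg j i
    split_ifs with hj
    · rw [← Finset.add_sum_erase _ _ hj, hp.diag, zero_add, ← Finset.card_erase_of_mem hj,
        Finset.sum_congr rfl (g := fun _ => (1 : ℝ))]
      · simp
      · intro i hi
        by_contra h
        exact hdisj i (hFE j hj i (Finset.ne_of_mem_erase hi).symm h) (Finset.mem_of_mem_erase hi)
    · by_cases hjE : j ∈ E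
      · have h1 : ∑ i ∈ F, p j i = (D j : ℝ) := by
          rw [← hp.row_sum j]
          refine Finset.sum_subset (Finset.subset_univ _) fun i _ hi => ?_
          by_contra h
          refine hi (hEF j hjE i ?_ h)
          rintro rfl
          exact h (hp.diag _)
        have h2 : (D j : ℝ) ≤ (F.card : ℝ) := by
          rw [← h1]
          simpa using Finset.sum_le_sum fun i (_ : i ∈ F) => hp.le_one j i
        rw [h1, min_eq_right (by exact_mod_cast h2)]
      · have h1 : ∑ i ∈ F, p j i = (F.card : ℝ) := by
          rw [Finset.sum_congr rfl (g := fun _ => (1 : ℝ))]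
          · simp
          · intro i hi
            by_contra h
            refine hjE (hFE i hi j ?_ (hp.symm i j ▸ h))
            rintro rfl
            exact hj hi
        rw [h1] at hle
        rw [h1, min_eq_left (by exact_mod_cast hle)]
  have hsum : (∑ i ∈ F, (D i : ℝ))
      = ((F.card * (F.card - 1) + ∑ i ∈ Fᶜ, min F.card (D i) : ℕ) : ℝ) := by
    calc ∑ i ∈ F, (D i : ℝ) = ∑ i ∈ F, ∑ j, p i j := by simp_rw [hp.row_sum]
      _ = ∑ j, ∑ i ∈ F, p j i := by
        rw [Finset.sum_comm]
        exact Finset.sum_congr rfl fun j _ => Finset.sum_congr rfl fun i _ => hp.symm i j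
      _ = _ := by
        rw [← Finset.sum_add_sum_compl F, Nat.cast_add, Nat.cast_sum]
        congr 1
        · rw [Finset.sum_congr rfl fun j hj => (hcol j).trans (if_pos hj)]
          simp
        · exact Finset.sum_congr rfl fun j hj =>
            (hcol j).trans (if_neg (Finset.mem_compl.1 hj))
  have := hD.sum_lt hne
  rw [← Nat.cast_sum] at hsum
  exact this.ne (by exact_mod_cast hsum)

open Filter Topology

/-! ### The maximum-entropy point is interior -/

/-- One can move from a point of the polytope along a feasible direction with zero row sums. -/
theorem IsInPolytope.eventually_add {n : ℕ} {D : Fin n → ℕ} {p δ : Fin n → Fin n → ℝ}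
    (hp : IsInPolytope D p) (hδ : IsFeasibleDir p δ) (hrow : ∀ i, ∑ j, δ i j = 0) :
    ∀ᶠ t : ℝ in 𝓝[>] 0, IsInPolytope D fun i j => p i j + t * δ i j := by
  have hcont : ∀ i j, Tendsto (fun t : ℝ => p i j + t * δ i j) (𝓝[>] 0) (𝓝 (p i j)) := by
    intro i j
    have : Continuous fun t : ℝ => p i j + t * δ i j := by fun_prop
    simpa using (this.tendsto 0).mono_left nhdsWithin_le_nhds
  have h0 : ∀ i j, ∀ᶠ t : ℝ in 𝓝[>] 0, 0 ≤ p i j + t * δ i j := by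
    intro i j
    rcases (hp.nonneg i j).eq_or_lt with h | h
    · filter_upwards [self_mem_nhdsWithin] with t ht
      rw [← h, zero_add]
      exact mul_nonneg (le_of_lt ht) (hδ.nonneg i j h.symm)
    · filter_upwards [(hcont i j).eventually (lt_mem_nhds h)] with t ht using ht.le
  have h1 : ∀ i j, ∀ᶠ t : ℝ in 𝓝[>] 0, p i j + t * δ i j ≤ 1 := by
    intro i j
    rcases (hp.le_one i j).eq_or_lt with h | h
    · filter_upwards [self_mem_nhdsWithin] with t ht
      rw [h]
      have := mul_nonpos_of_nonneg_of_nonpos (le_of_lt ht) (hδ.nonpos i j h)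
      linarith
    · filter_upwards [(hcont i j).eventually (gt_mem_nhds h)] with t ht using ht.le
  filter_upwards [eventually_all.2 fun i => eventually_all.2 (h0 i),
    eventually_all.2 fun i => eventually_all.2 (h1 i)] with t ht0 ht1
  refine ⟨fun i j => by rw [hp.symm i j, hδ.symm i j], fun i => by rw [hp.diag, hδ.diag]; simp,
    ht0, ht1, fun i => ?_⟩
  rw [Finset.sum_add_distrib, ← Finset.mul_sum, hrow, hp.row_sum, mul_zero, add_zero]

/-- The binary entropy grows with infinite slope at `0`. -/
theorem eventually_mul_le_binEntropy_mul {d : ℝ} (hd : 0 < d) (K : ℝ) :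
    ∀ᶠ t : ℝ in 𝓝[>] 0, K * t ≤ Real.binEntropy (t * d) := by
  have h1 : Tendsto (fun t : ℝ => t * d) (𝓝[>] 0) (𝓝[>] 0) := by
    refine tendsto_nhdsWithin_iff.2 ⟨?_, ?_⟩
    · have : Continuous fun t : ℝ => t * d := by fun_prop
      simpa using (this.tendsto 0).mono_left nhdsWithin_le_nhds
    · filter_upwards [self_mem_nhdsWithin] with t ht using mul_pos ht hd
  have h2 := (Real.tendsto_log_nhdsGT_zero.comp h1).eventually (eventually_le_atBot (-(K / d)))
  have h3 : ∀ᶠ t : ℝ in 𝓝[>] 0, t * d < 1 :=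
    (h1.mono_right nhdsWithin_le_nhds).eventually (gt_mem_nhds one_pos)
  filter_upwards [h2, h3, self_mem_nhdsWithin] with t ht ht1 ht0
  have ht0 : 0 < t := ht0
  have hpos : 0 < t * d := mul_pos ht0 hd
  have hn : 0 ≤ Real.negMulLog (1 - t * d) :=
    Real.negMulLog_nonneg (by linarith) (by linarith)
  rw [Real.binEntropy_eq_negMulLog_add_negMulLog_one_sub]
  simp only [Function.comp] at ht
  have : t * d * (K / d) ≤ t * d * (-Real.log (t * d)) :=
    mul_le_mul_of_nonneg_left (by linarith) hpos.le
  have e : t * d * (K / d) = K * t := by field_simp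
  rw [e] at this
  unfold Real.negMulLog at *
  linarith

theorem hasDerivAt_binEntropy_add_mul {x : ℝ} (hx0 : x ≠ 0) (hx1 : x ≠ 1) (d : ℝ) :
    HasDerivAt (fun t : ℝ => Real.binEntropy (x + t * d))
      ((Real.log (1 - x) - Real.log x) * d) 0 := by
  have h2 : HasDerivAt (fun t : ℝ => x + t * d) d 0 := by
    simpa using ((hasDerivAt_id (0 : ℝ)).mul_const d).const_add x
  have h1 : HasDerivAt Real.binEntropy (Real.log (1 - x) - Real.log x) (x + 0 * d) := by
    simpa using Real.hasDerivAt_binEntropy hx0 hx1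
  exact h1.comp (0 : ℝ) h2

/-- Along a feasible direction the binary entropy of an entry has slope bounded below. -/
theorem exists_eventually_binEntropy_ge {x d : ℝ} (h0 : 0 ≤ x) (h1 : x ≤ 1)
    (hd0 : x = 0 → 0 ≤ d) (hd1 : x = 1 → d ≤ 0) :
    ∃ K : ℝ, ∀ᶠ t : ℝ in 𝓝[>] 0, Real.binEntropy x + K * t ≤ Real.binEntropy (x + t * d) := by
  by_cases hx : x = 0 ∨ x = 1
  · refine ⟨0, ?_⟩
    have hcont : Tendsto (fun t : ℝ => t * d) (𝓝[>] 0) (𝓝 0) := by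
      have : Continuous fun t : ℝ => t * d := by fun_prop
      simpa using (this.tendsto 0).mono_left nhdsWithin_le_nhds
    filter_upwards [hcont.eventually (gt_mem_nhds one_pos),
      hcont.eventually (lt_mem_nhds (neg_one_lt_zero)), self_mem_nhdsWithin] with t ht ht' ht0
    have ht0 : 0 < t := ht0
    rw [Real.binEntropy_eq_zero.2 hx, zero_mul, add_zero]
    rcases hx with rfl | rfl
    · have := mul_nonneg ht0.le (hd0 rfl)
      exact Real.binEntropy_nonneg (by linarith) (by linarith)
    · have := mul_nonpos_of_nonneg_of_nonpos ht0.le (hd1 rfl)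
      exact Real.binEntropy_nonneg (by linarith) (by linarith)
  · push Not at hx
    have hder := hasDerivAt_binEntropy_add_mul hx.1 hx.2 d
    set L := (Real.log (1 - x) - Real.log x) * d
    refine ⟨L - 1, ?_⟩
    have h3 := (hasDerivAt_iff_tendsto_slope_zero.1 hder).mono_left
      (nhdsWithin_mono (0 : ℝ) fun t (ht : t ∈ Set.Ioi 0) => ne_of_gt ht)
    filter_upwards [h3.eventually (lt_mem_nhds (sub_one_lt L)), self_mem_nhdsWithin]
      with t ht ht0
    have ht0 : 0 < t := ht0
    simp only [zero_add, zero_mul, add_zero, smul_eq_mul] at ht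
    rw [inv_mul_eq_div, lt_div_iff₀ ht0] at ht
    linarith

/-- A maximum-entropy point admits no feasible direction that enters the cube at an entry which
is `0` or `1`. -/
theorem IsMaxEntropy.eq_zero_of_isFeasibleDir {n : ℕ} {D : Fin n → ℕ} {p δ : Fin n → Fin n → ℝ}
    (hp : IsMaxEntropy D p) (hδ : IsFeasibleDir p δ) (hrow : ∀ i, ∑ j, δ i j = 0)
    {a b : Fin n} (hab : a < b) (h : p a b = 0 ∨ p a b = 1) : δ a b = 0 := by
  by_contra hne
  set S := Finset.univ.filter fun e : Fin n × Fin n => e.1 < e.2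
  have hmem : (a, b) ∈ S := by simpa [S] using hab
  choose K hK using fun e : Fin n × Fin n => exists_eventually_binEntropy_ge
    (hp.1.nonneg e.1 e.2) (hp.1.le_one e.1 e.2) (hδ.nonneg e.1 e.2) (hδ.nonpos e.1 e.2)
  let C := ∑ e ∈ S.erase (a, b), K e
  have hfast : ∀ᶠ t : ℝ in 𝓝[>] 0,
      (1 - C) * t ≤ Real.binEntropy (p a b + t * δ a b) := by
    rcases h with h | h
    · rw [h]
      simp only [zero_add]
      exact eventually_mul_le_binEntropy_mul (lt_of_le_of_ne (hδ.nonneg a b h) (Ne.symm hne)) _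
    · have := eventually_mul_le_binEntropy_mul
        (neg_pos.2 (lt_of_le_of_ne (hδ.nonpos a b h) hne)) (1 - C)
      filter_upwards [this] with t ht
      rw [h, ← Real.binEntropy_one_sub]
      convert ht using 2
      ring
  obtain ⟨t, ht, htK, hpoly, ht0⟩ := (hfast.and ((eventually_all.2 hK).and
    ((hp.1.eventually_add hδ hrow).and self_mem_nhdsWithin))).exists
  have ht0 : 0 < t := ht0
  have hle := hp.2 _ hpoly
  unfold entropy at hle
  rw [← Finset.add_sum_erase _ _ hmem, ← Finset.add_sum_erase _ _ hmem] at hle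
  have h1 : ∑ e ∈ S.erase (a, b), (Real.binEntropy (p e.1 e.2) + K e * t)
      ≤ ∑ e ∈ S.erase (a, b), Real.binEntropy (p e.1 e.2 + t * δ e.1 e.2) :=
    Finset.sum_le_sum fun e _ => htK e
  rw [Finset.sum_add_distrib, ← Finset.sum_mul] at h1
  have h2 : Real.binEntropy (p a b) = 0 := Real.binEntropy_eq_zero.2 h
  have h3 : (1 - C) * t + C * t = t := by ring
  simp only [h2] at hle
  change ∑ e ∈ S.erase (a, b), Real.binEntropy (p e.1 e.2) + C * t ≤ _ at h1
  linarith

theorem IsMaxEntropy.ne_zero_and_ne_one {n : ℕ} {D : Fin n → ℕ} {p : Fin n → Fin n → ℝ}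
    (hD : IsStrictGraphic D) (hp : IsMaxEntropy D p) {a b : Fin n} (hab : a < b) :
    p a b ≠ 0 ∧ p a b ≠ 1 := by
  suffices key : ∀ c : ℝ, (c = 1 ∨ c = -1) → (p a b = 0 → 0 ≤ c) → (p a b = 1 → c ≤ 0) →
      (p a b = 0 ∨ p a b = 1) → False by
    exact ⟨fun h => key 1 (by simp) (by norm_num) (by simp [h]) (.inl h),
      fun h => key (-1) (by simp) (by simp [h]) (by norm_num) (.inr h)⟩
  intro c hc h0 h1 h
  have hc' : -c = 1 ∨ -c = -1 := by
    rcases hc with rfl | rfl <;> simp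
  obtain ⟨δ, hδ, hrow⟩ := ((hD.isFeasibleRowSum_single hp.1 a hc').add
    (hD.isFeasibleRowSum_single hp.1 b hc')).smul (c := 1 / 2) (by norm_num)
  have hedge := IsFeasibleDir.edge hp.1.symm hab.ne h0 h1
  have hdir : IsFeasibleDir p fun i j => δ i j + edgeDir a b c i j :=
    ⟨fun i j => by rw [hδ.symm, hedge.symm], fun i => by rw [hδ.diag, hedge.diag, add_zero],
      fun i j h => add_nonneg (hδ.nonneg i j h) (hedge.nonneg i j h),
      fun i j h => add_nonpos (hδ.nonpos i j h) (hedge.nonpos i j h)⟩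
  have hz := hp.eq_zero_of_isFeasibleDir hdir (fun i => by
    rw [Finset.sum_add_distrib, hrow, sum_edgeDir hab.ne]
    simp only [Pi.smul_apply, Pi.add_apply, Pi.single_apply, smul_eq_mul]
    split_ifs <;> ring) hab h
  simp only [edgeDir, and_self, true_or, if_true] at hz
  rcases h with h | h
  · have := hδ.nonneg a b h
    have := h0 h
    rcases hc with rfl | rfl <;> linarith
  · have := hδ.nonpos a b h
    have := h1 h
    rcases hc with rfl | rfl <;> linarith

/-! ### The mass of a graph with the prescribed degrees -/

/-- The first-order condition at an interior maximum-entropy point. -/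
theorem IsMaxEntropy.sum_mul_logit_eq_zero {n : ℕ} {D : Fin n → ℕ} {p δ : Fin n → Fin n → ℝ}
    (hD : IsStrictGraphic D) (hp : IsMaxEntropy D p) (hsymm : ∀ i j, δ i j = δ j i)
    (hdiag : ∀ i, δ i i = 0) (hrow : ∀ i, ∑ j, δ i j = 0) :
    ∑ e : Fin n × Fin n with e.1 < e.2,
      (Real.log (1 - p e.1 e.2) - Real.log (p e.1 e.2)) * δ e.1 e.2 = 0 := by
  suffices key : ∀ δ : Fin n → Fin n → ℝ, (∀ i j, δ i j = δ j i) → (∀ i, δ i i = 0) →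
      (∀ i, ∑ j, δ i j = 0) → ∑ e : Fin n × Fin n with e.1 < e.2,
      (Real.log (1 - p e.1 e.2) - Real.log (p e.1 e.2)) * δ e.1 e.2 ≤ 0 by
    refine le_antisymm (key δ hsymm hdiag hrow) ?_
    have := key (fun i j => -δ i j) (fun i j => by rw [hsymm]) (fun i => by simp [hdiag])
      (fun i => by simp [hrow])
    simpa using this
  clear hsymm hdiag hrow δ
  intro δ hsymm hdiag hrow
  have hpne : ∀ i j, i ≠ j → p i j ≠ 0 ∧ p i j ≠ 1 := fun i j hij => by
    rcases hij.lt_or_gt with h | h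
    · exact hp.ne_zero_and_ne_one hD h
    · rw [hp.1.symm]
      exact hp.ne_zero_and_ne_one hD h
  have hδ : IsFeasibleDir p δ := by
    refine ⟨hsymm, hdiag, fun i j h => ?_, fun i j h => ?_⟩ <;>
    · by_cases hij : i = j
      · subst hij
        rw [hdiag]
      · have := hpne i j hij
        tauto
  have hder : HasDerivAt (fun t : ℝ => entropy fun i j => p i j + t * δ i j)
      (∑ e : Fin n × Fin n with e.1 < e.2,
        (Real.log (1 - p e.1 e.2) - Real.log (p e.1 e.2)) * δ e.1 e.2) 0 := by
    unfold entropy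
    refine HasDerivAt.fun_sum fun e he => ?_
    have hne := hpne e.1 e.2 (Finset.mem_filter.1 he).2.ne
    exact hasDerivAt_binEntropy_add_mul hne.1 hne.2 _
  have h3 := (hasDerivAt_iff_tendsto_slope_zero.1 hder).mono_left
    (nhdsWithin_mono (0 : ℝ) fun t (ht : t ∈ Set.Ioi 0) => ne_of_gt ht)
  refine le_of_tendsto h3 ?_
  filter_upwards [hp.1.eventually_add hδ hrow, self_mem_nhdsWithin] with t ht ht0
  have ht0 : 0 < t := ht0
  have := hp.2 _ ht
  simp only [zero_add, zero_mul, add_zero, smul_eq_mul]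
  exact mul_nonpos_of_nonneg_of_nonpos (inv_nonneg.2 ht0.le) (by linarith)

theorem sum_adj_eq_degree {n : ℕ} (G : SimpleGraph (Fin n)) (i : Fin n) :
    ∑ j, (if G.Adj i j then (1 : ℝ) else 0) = G.degree i := by
  rw [Finset.sum_boole, ← SimpleGraph.card_neighborFinset_eq_degree]
  congr 2
  ext j
  simp

theorem mem_graphs {n : ℕ} {D : Fin n → ℕ} {G : SimpleGraph (Fin n)} :
    G ∈ graphs D ↔ ∀ i, G.degree i = D i := by
  simp [graphs]

theorem IsMaxEntropy.bernoulliMass_eq {n : ℕ} {D : Fin n → ℕ} {p : Fin n → Fin n → ℝ}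
    (hD : IsStrictGraphic D) (hp : IsMaxEntropy D p) {G : SimpleGraph (Fin n)}
    (hG : G ∈ graphs D) : bernoulliMass p G = Real.exp (-entropy p) := by
  have hfo := hp.sum_mul_logit_eq_zero hD
    (δ := fun i j => (if G.Adj i j then (1 : ℝ) else 0) - p i j)
    (fun i j => by simp only [G.adj_comm i j, hp.1.symm i j]) (fun i => by simp [hp.1.diag])
    (fun i => by
      rw [Finset.sum_sub_distrib, sum_adj_eq_degree, hp.1.row_sum, mem_graphs.1 hG, sub_self])
  unfold bernoulliMass entropy
  rw [← sub_zero (-_), ← hfo, ← Finset.sum_neg_distrib, ← Finset.sum_sub_distrib, Real.exp_sum]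
  refine Finset.prod_congr rfl fun e he => ?_
  have hne := hp.ne_zero_and_ne_one hD (Finset.mem_filter.1 he).2
  have h0 : 0 < p e.1 e.2 := lt_of_le_of_ne (hp.1.nonneg _ _) hne.1.symm
  have h1 : 0 < 1 - p e.1 e.2 := sub_pos.2 (lt_of_le_of_ne (hp.1.le_one _ _) hne.2)
  rw [Real.binEntropy_eq_negMulLog_add_negMulLog_one_sub]
  unfold Real.negMulLog
  split_ifs with h
  · conv_lhs => rw [← Real.exp_log h0]
    congr 1
    ring
  · conv_lhs => rw [← Real.exp_log h1]
    congr 1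
    ring

theorem IsMaxEntropy.bernoulliProb_graphs {n : ℕ} {D : Fin n → ℕ} {p : Fin n → Fin n → ℝ}
    (hD : IsStrictGraphic D) (hp : IsMaxEntropy D p) :
    bernoulliProb p (graphs D) = (graphs D).card * Real.exp (-entropy p) := by
  unfold bernoulliProb
  rw [Finset.sum_congr rfl fun G hG => hp.bernoulliMass_eq hD hG]
  simp

/-! ### Expectations for the independent-edge random graph -/

theorem sum_graph_prod_ite {n : ℕ} (f g : Fin n × Fin n → ℝ) :
    ∑ G : SimpleGraph (Fin n), ∏ e : Fin n × Fin n with e.1 < e.2,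
      (if G.Adj e.1 e.2 then f e else g e)
      = ∏ e : Fin n × Fin n with e.1 < e.2, (f e + g e) := by
  set S := Finset.univ.filter fun e : Fin n × Fin n => e.1 < e.2 with hS
  rw [Finset.prod_add]
  refine Finset.sum_bij' (fun G _ => S.filter fun e => G.Adj e.1 e.2)
    (fun t _ => SimpleGraph.fromRel fun i j => (i, j) ∈ t) ?_ ?_ ?_ ?_ ?_
  · intro G _
    exact Finset.mem_powerset.2 (Finset.filter_subset _ _)
  · intro t _
    exact Finset.mem_univ _
  · intro G _
    ext i j
    simp only [SimpleGraph.fromRel_adj, hS, Finset.mem_filter, Finset.mem_univ, true_and,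
      G.adj_comm j i, ← or_and_right]
    constructor
    · exact fun h => h.2.2
    · exact fun h => ⟨h.ne, h.ne.lt_or_gt, h⟩
  · intro t ht
    ext ⟨i, j⟩
    have hsub : ∀ a b, (a, b) ∈ t → a < b := fun a b h => by
      simpa [hS] using Finset.mem_powerset.1 ht h
    simp only [hS, Finset.mem_filter, Finset.mem_univ, true_and, SimpleGraph.fromRel_adj]
    constructor
    · rintro ⟨hij, -, h | h⟩
      · exact h
      · exact absurd (hsub _ _ h) hij.not_gt
    · exact fun h => ⟨hsub _ _ h, (hsub _ _ h).ne, .inl h⟩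
  · intro G _
    rw [Finset.prod_ite, Finset.filter_not]

theorem bernoulliMass_nonneg {n : ℕ} {p : Fin n → Fin n → ℝ} (h0 : ∀ i j, 0 ≤ p i j)
    (h1 : ∀ i j, p i j ≤ 1) (G : SimpleGraph (Fin n)) : 0 ≤ bernoulliMass p G := by
  refine Finset.prod_nonneg fun e _ => ?_
  split_ifs
  · exact h0 _ _
  · exact sub_nonneg.2 (h1 _ _)

theorem sum_sum_eq_sum_lt {n : ℕ} (f : Fin n → Fin n → ℝ) (hf : ∀ i, f i i = 0) :
    ∑ i, ∑ j, f i j = ∑ e : Fin n × Fin n with e.1 < e.2, (f e.1 e.2 + f e.2 e.1) := by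
  rw [Finset.sum_add_distrib, ← Finset.univ_product_univ, ← Finset.sum_product',
    ← Finset.sum_filter_add_sum_filter_not _ (fun e : Fin n × Fin n => e.1 < e.2)]
  congr 1
  have h1 : ∑ e : Fin n × Fin n with e.1 < e.2, f e.2 e.1
      = ∑ e : Fin n × Fin n with e.2 < e.1, f e.1 e.2 := by
    refine Finset.sum_bij' (fun e _ => e.swap) (fun e _ => e.swap) ?_ ?_ ?_ ?_ ?_ <;> simp
  simp only [Finset.univ_product_univ]
  rw [h1]
  symm
  refine Finset.sum_subset (fun e he => ?_) fun e he he' => ?_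
  · simp only [Finset.mem_filter, Finset.mem_univ, true_and] at he ⊢
    exact he.not_gt
  · simp only [Finset.mem_filter, Finset.mem_univ, true_and] at he he'
    have : e.1 = e.2 := le_antisymm (not_lt.1 he') (not_lt.1 he)
    rw [this, hf]

theorem exp_le_one_add_add_sq {y : ℝ} (hy : |y| ≤ 1) : Real.exp y ≤ 1 + y + y ^ 2 := by
  have := Real.abs_exp_sub_one_sub_id_le hy
  have := (abs_le.1 this).2
  linarith

theorem bernoulli_mgf_le {p y : ℝ} (h0 : 0 ≤ p) (h1 : p ≤ 1) (hy : |y| ≤ 1) :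
    p * Real.exp (y * (1 - p)) + (1 - p) * Real.exp (y * (0 - p)) ≤ Real.exp (y ^ 2 * p) := by
  have e1 : |y * (1 - p)| ≤ 1 := by
    rw [abs_mul, abs_of_nonneg (sub_nonneg.2 h1)]
    nlinarith [abs_nonneg y]
  have e2 : |y * (0 - p)| ≤ 1 := by
    rw [abs_mul, zero_sub, abs_neg, abs_of_nonneg h0]
    nlinarith [abs_nonneg y]
  have h2 := mul_le_mul_of_nonneg_left (exp_le_one_add_add_sq e1) h0
  have h3 := mul_le_mul_of_nonneg_left (exp_le_one_add_add_sq e2) (sub_nonneg.2 h1)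
  have h4 := Real.add_one_le_exp (y ^ 2 * p)
  have h5 : 0 ≤ y ^ 2 * p ^ 2 := by positivity
  nlinarith

/-- Exponential moments of a linear statistic of the independent-edge random graph. -/
theorem sum_bernoulliMass_exp_le {n : ℕ} {D : Fin n → ℕ} {p : Fin n → Fin n → ℝ}
    (hp : IsInPolytope D p) {a : Fin n → Fin n → ℝ} {l : ℝ} (hl0 : 0 ≤ l) (hl : l ≤ 1 / 2)
    (ha : ∀ i j, |a i j| ≤ 1) :
    ∑ G : SimpleGraph (Fin n), bernoulliMass p G *
      Real.exp (l * ∑ i, ∑ j, a i j * ((if G.Adj i j then 1 else 0) - p i j))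
      ≤ Real.exp (2 * l ^ 2 * total D) := by
  set S := Finset.univ.filter fun e : Fin n × Fin n => e.1 < e.2 with hS
  let b : Fin n × Fin n → ℝ := fun e => l * (a e.1 e.2 + a e.2 e.1)
  have hb : ∀ e, |b e| ≤ 2 * l := fun e => by
    simp only [b]
    rw [abs_mul, abs_of_nonneg hl0]
    have := abs_add_le (a e.1 e.2) (a e.2 e.1)
    have := ha e.1 e.2
    have := ha e.2 e.1
    nlinarith
  have h1 : ∀ G : SimpleGraph (Fin n), bernoulliMass p G *
      Real.exp (l * ∑ i, ∑ j, a i j * ((if G.Adj i j then 1 else 0) - p i j))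
      = ∏ e ∈ S, if G.Adj e.1 e.2 then p e.1 e.2 * Real.exp (b e * (1 - p e.1 e.2))
        else (1 - p e.1 e.2) * Real.exp (b e * (0 - p e.1 e.2)) := by
    intro G
    rw [sum_sum_eq_sum_lt _ (fun i => by simp [hp.diag]), Finset.mul_sum, Real.exp_sum]
    unfold bernoulliMass
    rw [← Finset.prod_mul_distrib]
    refine Finset.prod_congr rfl fun e _ => ?_
    rw [G.adj_comm e.2 e.1, hp.symm e.2 e.1]
    split_ifs
    · congr 2
      simp only [b]
      ring
    · congr 2
      simp only [b]
      ring
  rw [Finset.sum_congr rfl fun G _ => h1 G, sum_graph_prod_ite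
    (fun e => p e.1 e.2 * Real.exp (b e * (1 - p e.1 e.2)))
    (fun e => (1 - p e.1 e.2) * Real.exp (b e * (0 - p e.1 e.2)))]
  have h2 : (total D : ℝ) = 2 * ∑ e ∈ S, p e.1 e.2 := by
    have := sum_sum_eq_sum_lt p hp.diag
    simp_rw [hp.row_sum] at this
    rw [total, Nat.cast_sum, this, Finset.mul_sum]
    exact Finset.sum_congr rfl fun e _ => by rw [hp.symm e.2 e.1]; ring
  calc _ ≤ ∏ e ∈ S, Real.exp (4 * l ^ 2 * p e.1 e.2) := by
        refine Finset.prod_le_prod (fun e _ => ?_) fun e _ => ?_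
        · exact add_nonneg (mul_nonneg (hp.nonneg _ _) (Real.exp_pos _).le)
            (mul_nonneg (sub_nonneg.2 (hp.le_one _ _)) (Real.exp_pos _).le)
        · refine (bernoulli_mgf_le (hp.nonneg _ _) (hp.le_one _ _)
            ((hb e).trans (by linarith))).trans (Real.exp_le_exp.2 ?_)
          refine mul_le_mul_of_nonneg_right ?_ (hp.nonneg _ _)
          have := sq_le_sq' (by linarith [neg_le_of_abs_le (hb e)]) (le_of_abs_le (hb e))
          linarith
    _ = Real.exp (2 * l ^ 2 * total D) := by
        rw [← Real.exp_sum, ← Finset.mul_sum, h2]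
        congr 1
        ring

/-! ### Comparing the uniform graph with the independent-edge graph -/

/-- Jensen's inequality for the logarithm, comparing the uniform random graph with the
independent-edge random graph it is a conditioning of. -/
theorem IsMaxEntropy.sum_log_div_card_le {n : ℕ} {D : Fin n → ℕ} {p : Fin n → Fin n → ℝ}
    (hD : IsStrictGraphic D) (hp : IsMaxEntropy D p) (hne : 0 < (graphs D).card)
    {X : SimpleGraph (Fin n) → ℝ} (hX : ∀ G, 0 < X G) {C : ℝ} (hC : 0 < C)
    (hXC : ∑ G, bernoulliMass p G * X G ≤ C) :
    (∑ G ∈ graphs D, Real.log (X G)) / (graphs D).card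
      ≤ Real.log (C / bernoulliProb p (graphs D)) := by
  have hcard : (0 : ℝ) < (graphs D).card := by exact_mod_cast hne
  set K := C / bernoulliProb p (graphs D) with hK
  have hP := hp.bernoulliProb_graphs hD
  have hPpos : 0 < bernoulliProb p (graphs D) := hP ▸ mul_pos hcard (Real.exp_pos _)
  have hKpos : 0 < K := div_pos hC hPpos
  rw [div_le_iff₀ hcard]
  have h1 : ∀ G, Real.log (X G) ≤ X G / K - 1 + Real.log K := fun G => by
    have := Real.log_le_sub_one_of_pos (div_pos (hX G) hKpos)
    rw [Real.log_div (hX G).ne' hKpos.ne'] at this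
    linarith
  have h2 : (∑ G ∈ graphs D, X G) / K ≤ (graphs D).card := by
    have h3 : Real.exp (-entropy p) * ∑ G ∈ graphs D, X G ≤ C := by
      refine le_trans ?_ hXC
      rw [Finset.mul_sum, Finset.sum_congr rfl fun G hG => by rw [← hp.bernoulliMass_eq hD hG]]
      exact Finset.sum_le_sum_of_subset_of_nonneg (Finset.subset_univ _) fun G _ _ =>
        mul_nonneg (bernoulliMass_nonneg hp.1.nonneg hp.1.le_one G) (hX G).le
    rw [div_le_iff₀ hKpos, hK, hP, ← mul_div_assoc, mul_div_mul_left _ _ hcard.ne',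
      le_div_iff₀ (Real.exp_pos _)]
    linarith
  calc ∑ G ∈ graphs D, Real.log (X G)
      ≤ ∑ G ∈ graphs D, (X G / K - 1 + Real.log K) := Finset.sum_le_sum fun G _ => h1 G
    _ = (∑ G ∈ graphs D, X G) / K - (graphs D).card + (graphs D).card * Real.log K := by
      rw [Finset.sum_add_distrib, Finset.sum_sub_distrib, Finset.sum_div]
      simp
    _ ≤ Real.log K * (graphs D).card := by linarith

theorem exists_sign_mul_eq_abs (x : ℝ) : ∃ ξ : ℝ, |ξ| ≤ 1 ∧ |x| = ξ * x := by
  rcases abs_choice x with h | h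
  · exact ⟨1, by simp, by rw [h, one_mul]⟩
  · exact ⟨-1, by simp, by rw [h]; ring⟩

theorem sum_prod_sum_exp_le {n : ℕ} {D : Fin n → ℕ} {p : Fin n → Fin n → ℝ}
    (hp : IsInPolytope D p) {J : Type*} [Fintype J] {ξ : J → Fin n → ℝ}
    (hξ : ∀ o w, |ξ o w| ≤ 1) {l : ℝ} (hl0 : 0 ≤ l) (hl : l ≤ 1 / 2) :
    ∑ G : SimpleGraph (Fin n), bernoulliMass p G *
      ∏ v, ∑ o, Real.exp (l * ∑ w, ξ o w * ((if G.Adj v w then 1 else 0) - p v w))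
      ≤ (Fintype.card J : ℝ) ^ n * Real.exp (2 * l ^ 2 * total D) := by
  have h1 : ∀ G : SimpleGraph (Fin n),
      ∏ v, ∑ o, Real.exp (l * ∑ w, ξ o w * ((if G.Adj v w then 1 else 0) - p v w))
      = ∑ σ : Fin n → J, Real.exp (l * ∑ v, ∑ w,
          ξ (σ v) w * ((if G.Adj v w then 1 else 0) - p v w)) := fun G => by
    rw [Fintype.prod_sum]
    refine Finset.sum_congr rfl fun σ _ => ?_
    rw [← Real.exp_sum, Finset.mul_sum]
  simp_rw [h1, Finset.mul_sum Finset.univ _ (bernoulliMass p _)]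
  rw [Finset.sum_comm]
  calc _ ≤ ∑ _σ : Fin n → J, Real.exp (2 * l ^ 2 * total D) :=
        Finset.sum_le_sum fun σ _ => sum_bernoulliMass_exp_le hp hl0 hl fun v w => hξ (σ v) w
    _ = _ := by simp

/-- A subconvex combination of numbers is at most the logarithm of the sum of exponentials. -/
theorem sum_mul_le_log_sum_exp {I : Type*} [Fintype I] {s : Finset I} {W : I → ℝ}
    (hW : ∀ i, 0 ≤ W i) (hsum : ∑ i ∈ s, W i ≤ 1) {z : Option I → ℝ} (hz : z none = 0) :
    ∑ i ∈ s, W i * z (some i) ≤ Real.log (∑ o, Real.exp (z o)) := by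
  have hle : ∀ o, z o ≤ Real.log (∑ o, Real.exp (z o)) := fun o => by
    rw [← Real.log_exp (z o)]
    exact Real.log_le_log (Real.exp_pos _)
      (Finset.single_le_sum (f := fun o => Real.exp (z o)) (fun o _ => (Real.exp_pos _).le)
        (Finset.mem_univ o))
  have h0 := hle none
  rw [hz] at h0
  calc ∑ i ∈ s, W i * z (some i) ≤ ∑ i ∈ s, W i * Real.log (∑ o, Real.exp (z o)) :=
        Finset.sum_le_sum fun i _ => mul_le_mul_of_nonneg_left (hle _) (hW i)
    _ ≤ _ := by
      rw [← Finset.sum_mul]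
      exact mul_le_of_le_one_left h0 hsum

/-- The main estimate: exploring one more edge from the end of a randomly chosen pattern. -/
theorem IsMaxEntropy.sum_abs_edge_deviation_le {n : ℕ} {D : Fin n → ℕ} {p : Fin n → Fin n → ℝ}
    (hD : IsStrictGraphic D) (hp : IsMaxEntropy D p) (hn : 2 ≤ n) {η : ℝ} (hη : 0 < η)
    (hP : Real.exp (-η * n * Real.log n) ≤ bernoulliProb p (graphs D))
    {I : Type*} [Fintype I] {m : ℕ} (hI : Fintype.card I + 1 ≤ n ^ m) (r : I → Fin n)
    {W : I → SimpleGraph (Fin n) → ℝ} (hW0 : ∀ i G, 0 ≤ W i G)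
    (hW : ∀ G ∈ graphs D, ∀ v, ∑ i with r i = v, W i G ≤ 1) :
    ∑ i, ∑ w, |(∑ G ∈ graphs D, W i G * ((if G.Adj (r i) w then 1 else 0) - p (r i) w))
        / (graphs D).card|
      ≤ (2 * (η + m) + 2) * Real.sqrt (total D * (n * Real.log n)) := by
  have hPpos : 0 < bernoulliProb p (graphs D) := (Real.exp_pos _).trans_le hP
  have hne : 0 < (graphs D).card := by
    rw [Nat.pos_iff_ne_zero]
    intro h
    rw [hp.bernoulliProb_graphs hD, h] at hPpos
    simp at hPpos
  have hcard : (0 : ℝ) < (graphs D).card := by exact_mod_cast hne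
  choose ξ hξ1 hξ using fun (i : I) (w : Fin n) => exists_sign_mul_eq_abs
    ((∑ G ∈ graphs D, W i G * ((if G.Adj (r i) w then 1 else 0) - p (r i) w))
        / (graphs D).card)
  let ζ : Option I → Fin n → ℝ := fun o w => o.elim 0 fun i => ξ i w
  have hζ1 : ∀ o w, |ζ o w| ≤ 1 := fun o w => by
    cases o with
    | none => simp [ζ]
    | some i => exact hξ1 i w
  let Z : Fin n → Option I → SimpleGraph (Fin n) → ℝ := fun v o G =>
    ∑ w, ζ o w * ((if G.Adj v w then 1 else 0) - p v w)
  let f : SimpleGraph (Fin n) → ℝ := fun G => ∑ v, ∑ i with r i = v, W i G * Z v (some i) G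
  have hlhs : ∑ i, ∑ w, |(∑ G ∈ graphs D, W i G * ((if G.Adj (r i) w then 1 else 0) - p (r i) w))
        / (graphs D).card| = (∑ G ∈ graphs D, f G) / (graphs D).card := by
    have hf : ∀ G, f G = ∑ i, ∑ w, ξ i w *
        (W i G * ((if G.Adj (r i) w then 1 else 0) - p (r i) w)) := fun G => by
      refine Eq.trans ?_ (Finset.sum_fiberwise Finset.univ r _)
      refine Finset.sum_congr rfl fun v _ => ?_
      refine Finset.sum_congr rfl fun i hi => ?_
      rw [(Finset.mem_filter.1 hi).2, Finset.mul_sum]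
      exact Finset.sum_congr rfl fun w _ => by simp only [ζ, Option.elim]; ring
    simp_rw [hf, hξ]
    symm
    rw [Finset.sum_comm, Finset.sum_div]
    refine Finset.sum_congr rfl fun i _ => ?_
    rw [Finset.sum_comm, Finset.sum_div]
    refine Finset.sum_congr rfl fun w _ => ?_
    rw [← Finset.mul_sum, mul_div_assoc]
  rw [hlhs]
  set M : ℝ := (total D : ℝ) with hM
  set L : ℝ := n * Real.log n with hL
  have hn' : (2 : ℝ) ≤ n := by exact_mod_cast hn
  have hLpos : 0 < L := mul_pos (by linarith) (Real.log_pos (by linarith))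
  have hMnn : 0 ≤ M := Nat.cast_nonneg _
  have hsqrt : 0 ≤ Real.sqrt (M * L) := Real.sqrt_nonneg _
  have hm : (0 : ℝ) ≤ m := Nat.cast_nonneg _
  rcases lt_or_ge M L with hML | hML
  · have hf2 : ∀ G ∈ graphs D, f G ≤ 2 * M := by
      intro G hG
      have hZ : ∀ v o, Z v o G ≤ 2 * D v := by
        intro v o
        calc Z v o G ≤ ∑ w, ((if G.Adj v w then 1 else 0) + p v w) := by
              refine Finset.sum_le_sum fun w _ => ?_
              refine (le_abs_self _).trans ?_
              rw [abs_mul]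
              refine (mul_le_of_le_one_left (abs_nonneg _) (hζ1 o w)).trans ?_
              refine (abs_sub _ _).trans ?_
              rw [abs_of_nonneg (hp.1.nonneg v w)]
              split_ifs <;> simp
          _ = 2 * D v := by
              rw [Finset.sum_add_distrib, sum_adj_eq_degree, hp.1.row_sum, mem_graphs.1 hG]
              ring
      calc f G ≤ ∑ v, ∑ i with r i = v, W i G * (2 * D v) :=
            Finset.sum_le_sum fun v _ => Finset.sum_le_sum fun i _ =>
              mul_le_mul_of_nonneg_left (hZ _ _) (hW0 _ _)
        _ ≤ ∑ v, 2 * (D v : ℝ) := Finset.sum_le_sum fun v _ => by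
            rw [← Finset.sum_mul]
            exact mul_le_of_le_one_left (by positivity) (hW G hG v)
        _ = 2 * M := by rw [← Finset.mul_sum, hM, total, Nat.cast_sum]
    have h1 : (∑ G ∈ graphs D, f G) / (graphs D).card ≤ 2 * M := by
      rw [div_le_iff₀ hcard, mul_comm, ← nsmul_eq_mul]
      exact Finset.sum_le_card_nsmul _ _ _ hf2
    have h2 : M ≤ Real.sqrt (M * L) := Real.le_sqrt_of_sq_le (by nlinarith)
    nlinarith [mul_nonneg (add_nonneg hη.le hm) hsqrt]
  · have hMpos : 0 < M := hLpos.trans_le hML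
    set q := Real.sqrt (L / M) with hq
    have hqpos : 0 < q := Real.sqrt_pos.2 (div_pos hLpos hMpos)
    have hq1 : q ≤ 1 := Real.sqrt_le_one.2 ((div_le_one hMpos).2 hML)
    have hq2 : q ^ 2 * M = L := by
      rw [hq, Real.sq_sqrt (div_pos hLpos hMpos).le]
      field_simp
    have hqs : q * M = Real.sqrt (M * L) := by
      rw [← hq2, show M * (q ^ 2 * M) = (q * M) ^ 2 by ring, Real.sqrt_sq (by positivity)]
    let l := q / 2
    have hlpos : 0 < l := by positivity
    let X : SimpleGraph (Fin n) → ℝ := fun G => ∏ v, ∑ o, Real.exp (l * Z v o G)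
    have hSpos : ∀ v G, 0 < ∑ o, Real.exp (l * Z v o G) := fun v G =>
      Finset.sum_pos (fun o _ => Real.exp_pos _) Finset.univ_nonempty
    have hXpos : ∀ G, 0 < X G := fun G => Finset.prod_pos fun v _ => hSpos v G
    have hfX : ∀ G ∈ graphs D, l * f G ≤ Real.log (X G) := by
      intro G hG
      rw [Real.log_prod fun v _ => (hSpos v G).ne', Finset.mul_sum]
      refine Finset.sum_le_sum fun v _ => ?_
      have := sum_mul_le_log_sum_exp (fun i => hW0 i G) (hW G hG v)
        (z := fun o => l * Z v o G) (by simp [Z, ζ])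
      refine le_trans (le_of_eq ?_) this
      rw [Finset.mul_sum]
      exact Finset.sum_congr rfl fun i _ => by ring
    have hEX := sum_prod_sum_exp_le (D := D) hp.1 hζ1 hlpos.le
      (show l ≤ 1 / 2 by simp only [l]; linarith)
    have hJ : (0 : ℝ) < Fintype.card (Option I) := by
      rw [Fintype.card_option]
      positivity
    have h1 := hp.sum_log_div_card_le hD hne hXpos (mul_pos (pow_pos hJ n) (Real.exp_pos _)) hEX
    have h2 : l * ((∑ G ∈ graphs D, f G) / (graphs D).card)
        ≤ (∑ G ∈ graphs D, Real.log (X G)) / (graphs D).card := by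
      rw [← mul_div_assoc, Finset.mul_sum]
      exact div_le_div_of_nonneg_right (Finset.sum_le_sum hfX) hcard.le
    have h3 : Real.log ((Fintype.card (Option I) : ℝ) ^ n * Real.exp (2 * l ^ 2 * total D)
        / bernoulliProb p (graphs D)) ≤ m * L + 2 * l ^ 2 * M + η * L := by
      rw [Real.log_div (by positivity) hPpos.ne', Real.log_mul (by positivity)
        (Real.exp_pos _).ne', Real.log_pow, Real.log_exp]
      have h4 := Real.log_le_log (Real.exp_pos _) hP
      rw [Real.log_exp] at h4
      have h5 : Real.log (Fintype.card (Option I) : ℝ) ≤ m * Real.log n := by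
        rw [← Real.log_pow]
        refine Real.log_le_log hJ ?_
        rw [Fintype.card_option]
        exact_mod_cast hI
      have h6 := mul_le_mul_of_nonneg_left h5 (Nat.cast_nonneg (α := ℝ) n)
      rw [hL]
      nlinarith
    have h7 : 2 * l ^ 2 * M = L / 2 := by
      simp only [l]
      linear_combination (1 / 2) * hq2
    have h8 : l * ((∑ G ∈ graphs D, f G) / (graphs D).card) ≤ (η + m + 1 / 2) * L := by
      linarith
    have h9 : L = 2 * l * Real.sqrt (M * L) := by
      rw [← hqs]
      simp only [l]
      linear_combination -hq2
    have h10 : (∑ G ∈ graphs D, f G) / (graphs D).card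
        ≤ (2 * (η + m) + 1) * Real.sqrt (M * L) := by
      refine le_of_mul_le_mul_left (h8.trans (le_of_eq ?_)) hlpos
      linear_combination (η + m + 1 / 2) * h9
    linarith

/-! ### Embeddings of trees on arbitrary finite vertex types -/

/-- The restriction of an embedding to the complement of a vertex. -/
def eraseVertex {V : Type} {n : ℕ} (ℓ : V) (s : V ↪ Fin n) : ({ℓ}ᶜ : Set V) ↪ Fin n :=
  (Function.Embedding.subtype _).trans s

@[simp] theorem eraseVertex_apply {V : Type} {n : ℕ} (ℓ : V) (s : V ↪ Fin n) (x : ({ℓ}ᶜ : Set V)) :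
    eraseVertex ℓ s x = s x := rfl

section Patterns

variable {V : Type} [Fintype V] {n : ℕ}

/-- The reciprocal of the `B`-function, for a tree on an arbitrary finite type. -/
def treeWeight (D : Fin n → ℕ) (s : V ↪ Fin n) (T : SimpleGraph V) : ℝ :=
  1 / ∏ u, (D (s u) : ℝ) ^ ((T.degree u : ℤ) - 1)

/-- The indicator that `s` maps every edge of `T` to an edge of `G`. -/
def patternIndicator (s : V ↪ Fin n) (T : SimpleGraph V) (G : SimpleGraph (Fin n)) : ℝ :=
  if ∀ u v, T.Adj u v → G.Adj (s u) (s v) then 1 else 0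

/-- The probability of a pattern in the uniform graph with degree sequence `D`. -/
def patternProbUniform (D : Fin n → ℕ) (s : V ↪ Fin n) (T : SimpleGraph V) : ℝ :=
  (∑ G ∈ graphs D, patternIndicator s T G) / ((graphs D).card : ℝ)

/-- The probability of a pattern in the independent-edge graph. -/
def patternProbBernoulli (p : Fin n → Fin n → ℝ) (s : V ↪ Fin n) (T : SimpleGraph V) : ℝ :=
  ∑ G : SimpleGraph (Fin n), bernoulliMass p G * patternIndicator s T G

theorem treeWeight_nonneg (D : Fin n → ℕ) (s : V ↪ Fin n) (T : SimpleGraph V) :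
    0 ≤ treeWeight D s T :=
  one_div_nonneg.2 (Finset.prod_nonneg fun _ _ => zpow_nonneg (Nat.cast_nonneg _) _)

theorem patternIndicator_nonneg (s : V ↪ Fin n) (T : SimpleGraph V) (G : SimpleGraph (Fin n)) :
    0 ≤ patternIndicator s T G := by
  unfold patternIndicator
  split_ifs <;> norm_num

/-- In the independent-edge graph the edges of a pattern appear independently. -/
theorem patternProbBernoulli_eq_prod {p : Fin n → Fin n → ℝ} (s : V ↪ Fin n)
    (T : SimpleGraph V) : patternProbBernoulli p s T =
      ∏ e : Fin n × Fin n with e.1 < e.2, if (T.map s).Adj e.1 e.2 then p e.1 e.2 else 1 := by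
  have h : ∀ G : SimpleGraph (Fin n), bernoulliMass p G * patternIndicator s T G
      = ∏ e : Fin n × Fin n with e.1 < e.2, if G.Adj e.1 e.2 then p e.1 e.2 else
          if (T.map s).Adj e.1 e.2 then 0 else 1 - p e.1 e.2 := by
    intro G
    unfold patternIndicator bernoulliMass
    split_ifs with hG
    · rw [mul_one]
      refine Finset.prod_congr rfl fun e _ => ?_
      split_ifs with h1 h2
      · rfl
      · obtain ⟨u, v, huv, hu, hv⟩ := SimpleGraph.map_adj _ _ _ _ |>.1 h2
        exact absurd (hu ▸ hv ▸ hG u v huv) h1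
      · rfl
    · rw [mul_zero]
      push Not at hG
      obtain ⟨u, v, huv, hG⟩ := hG
      have hmap : (T.map s).Adj (s u) (s v) := (SimpleGraph.map_adj_apply).2 huv
      symm
      rcases (s.injective.ne huv.ne).lt_or_gt with hlt | hlt
      · exact Finset.prod_eq_zero (i := (s u, s v)) (by simpa using hlt) (by simp [hG, hmap])
      · exact Finset.prod_eq_zero (i := (s v, s u)) (by simpa using hlt)
          (by simp [G.adj_comm (s v), hG, hmap.symm])
  unfold patternProbBernoulli
  rw [Finset.sum_congr rfl fun G _ => h G, sum_graph_prod_ite (fun e => p e.1 e.2)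
    (fun e => if (T.map s).Adj e.1 e.2 then 0 else 1 - p e.1 e.2)]
  refine Finset.prod_congr rfl fun e _ => ?_
  split_ifs <;> ring

@[to_additive]
theorem prod_eq_mul_prod_compl_singleton {M : Type*} [CommMonoid M] (ℓ : V) (f : V → M) :
    ∏ x, f x = f ℓ * ∏ x : ({ℓ}ᶜ : Set V), f x := by
  rw [Fintype.prod_eq_mul_prod_compl ℓ f]
  congr 1
  exact Finset.prod_subtype _ (by simp) f

theorem degree_eq_card_adj (T : SimpleGraph V) (x : V) [Fintype (T.neighborSet x)] :
    T.degree x = ∑ y, if T.Adj x y then 1 else 0 := by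
  rw [Finset.sum_boole, ← SimpleGraph.card_neighborFinset_eq_degree]
  simp only [Nat.cast_id]
  congr 1
  ext j
  simp

theorem sum_embedding_le (ℓ : V) {F : (({ℓ}ᶜ : Set V) ↪ Fin n) → Fin n → ℝ}
    (hF : ∀ s w, 0 ≤ F s w) :
    ∑ s : V ↪ Fin n, F (eraseVertex ℓ s) (s ℓ) ≤ ∑ s, ∑ w, F s w := by
  have hinj : Function.Injective fun s : V ↪ Fin n => (eraseVertex ℓ s, s ℓ) := by
    intro s t hst
    simp only [Prod.mk.injEq] at hst
    ext x : 1
    by_cases hx : x = ℓ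
    · rw [hx, hst.2]
    · exact DFunLike.congr_fun hst.1 (⟨x, hx⟩ : ({ℓ}ᶜ : Set V))
  rw [← Finset.sum_product', Finset.univ_product_univ,
    ← Finset.sum_image (s := Finset.univ) (f := fun x : (({ℓ}ᶜ : Set V) ↪ Fin n) × Fin n =>
      F x.1 x.2) (g := fun s : V ↪ Fin n => (eraseVertex ℓ s, s ℓ)) hinj.injOn]
  exact Finset.sum_le_sum_of_subset_of_nonneg (Finset.subset_univ _) fun x _ _ => hF _ _

theorem degree_eq_degree_induce_add {T : SimpleGraph V} {ℓ u : V} (hu : T.Adj u ℓ)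
    (huniq : ∀ v, T.Adj v ℓ → v = u) (x : ({ℓ}ᶜ : Set V)) :
    T.degree x = (T.induce {ℓ}ᶜ).degree x + if (x : V) = u then 1 else 0 := by
  rw [degree_eq_card_adj, degree_eq_card_adj, sum_eq_add_sum_compl_singleton ℓ, add_comm]
  congr 1
  have : T.Adj x ℓ ↔ (x : V) = u := ⟨huniq x, fun h => h ▸ hu⟩
  simp only [this]

theorem degree_leaf {T : SimpleGraph V} {ℓ u : V} (hu : T.Adj u ℓ)
    (huniq : ∀ v, T.Adj v ℓ → v = u) : T.degree ℓ = 1 :=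
  SimpleGraph.degree_eq_one_iff_existsUnique_adj.2 ⟨u, hu.symm, fun v hv => huniq v hv.symm⟩

theorem treeWeight_leaf {D : Fin n → ℕ} (hD : ∀ i, 0 < D i) {T : SimpleGraph V} {ℓ u : V}
    (hu : T.Adj u ℓ) (huniq : ∀ v, T.Adj v ℓ → v = u) (s : V ↪ Fin n) :
    treeWeight D s T = treeWeight D (eraseVertex ℓ s) (T.induce {ℓ}ᶜ) / D (s u) := by
  have hD' : ∀ i, (D i : ℝ) ≠ 0 := fun i => by exact_mod_cast (hD i).ne'
  unfold treeWeight
  rw [div_div]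
  congr 1
  rw [prod_eq_mul_prod_compl_singleton ℓ, degree_leaf hu huniq]
  simp only [Nat.cast_one, sub_self, zpow_zero, one_mul]
  have h1 : ∀ x : ({ℓ}ᶜ : Set V), (D (s x) : ℝ) ^ ((T.degree x : ℤ) - 1)
      = (D (eraseVertex ℓ s x) : ℝ) ^ (((T.induce {ℓ}ᶜ).degree x : ℤ) - 1)
        * if x = (⟨u, hu.ne⟩ : ({ℓ}ᶜ : Set V)) then (D (s u) : ℝ) else 1 := by
    intro x
    rw [degree_eq_degree_induce_add hu huniq]
    by_cases hx : (x : V) = u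
    · have hx' : x = (⟨u, hu.ne⟩ : ({ℓ}ᶜ : Set V)) := Subtype.ext hx
      rw [if_pos hx, if_pos hx', eraseVertex_apply, hx, ← zpow_add_one₀ (hD' _)]
      congr 1
      push_cast
      ring
    · have hx' : x ≠ (⟨u, hu.ne⟩ : ({ℓ}ᶜ : Set V)) := fun h => hx (congrArg Subtype.val h)
      rw [if_neg hx, if_neg hx', mul_one, add_zero, eraseVertex_apply]
  rw [Finset.prod_congr rfl fun x _ => h1 x, Finset.prod_mul_distrib, Finset.prod_ite_eq',
    if_pos (Finset.mem_univ _)]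
  congr!

theorem patternIndicator_leaf {T : SimpleGraph V} {ℓ u : V} (hu : T.Adj u ℓ)
    (huniq : ∀ v, T.Adj v ℓ → v = u) (s : V ↪ Fin n) (G : SimpleGraph (Fin n)) :
    patternIndicator s T G = patternIndicator (eraseVertex ℓ s) (T.induce {ℓ}ᶜ) G *
      if G.Adj (s u) (s ℓ) then 1 else 0 := by
  have : (∀ x y, T.Adj x y → G.Adj (s x) (s y)) ↔
      (∀ x y, (T.induce {ℓ}ᶜ).Adj x y → G.Adj (eraseVertex ℓ s x) (eraseVertex ℓ s y)) ∧
        G.Adj (s u) (s ℓ) := by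
    constructor
    · exact fun h => ⟨fun x y hxy => h x y hxy, h u ℓ hu⟩
    · rintro ⟨h1, h2⟩ x y hxy
      by_cases hy : y = ℓ
      · subst hy
        rw [huniq x hxy]
        exact h2
      by_cases hx : x = ℓ
      · subst hx
        rw [huniq y hxy.symm]
        exact h2.symm
      exact h1 ⟨x, hx⟩ ⟨y, hy⟩ hxy
  unfold patternIndicator
  simp only [this, ite_and]
  split_ifs <;> simp

theorem patternProbBernoulli_leaf {p : Fin n → Fin n → ℝ} (hp : ∀ i j, p i j = p j i)
    {T : SimpleGraph V} {ℓ u : V} (hu : T.Adj u ℓ) (huniq : ∀ v, T.Adj v ℓ → v = u)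
    (s : V ↪ Fin n) : patternProbBernoulli p s T
      = patternProbBernoulli p (eraseVertex ℓ s) (T.induce {ℓ}ᶜ) * p (s u) (s ℓ) := by
  have hne : s u ≠ s ℓ := s.injective.ne hu.ne
  obtain ⟨e₀, he₀, hpe₀, hiff⟩ : ∃ e₀ : Fin n × Fin n, e₀.1 < e₀.2 ∧
      p e₀.1 e₀.2 = p (s u) (s ℓ) ∧ ∀ e : Fin n × Fin n, e.1 < e.2 →
        (e = e₀ ↔ (e.1 = s u ∧ e.2 = s ℓ) ∨ (e.1 = s ℓ ∧ e.2 = s u)) := by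
    rcases hne.lt_or_gt with h | h
    · refine ⟨(s u, s ℓ), h, rfl, fun e he => ?_⟩
      rw [Prod.ext_iff]
      constructor
      · exact .inl
      · rintro (h' | ⟨h1, h2⟩)
        · exact h'
        · rw [h1, h2] at he
          exact absurd he h.not_gt
    · refine ⟨(s ℓ, s u), h, hp _ _, fun e he => ?_⟩
      rw [Prod.ext_iff]
      constructor
      · exact .inr
      · rintro (⟨h1, h2⟩ | h')
        · rw [h1, h2] at he
          exact absurd he h.not_gt
        · exact h'
  have hnot : ∀ i, ¬ ((T.induce {ℓ}ᶜ).map (eraseVertex ℓ s)).Adj i (s ℓ) := by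
    intro i h
    obtain ⟨x, y, -, -, hy⟩ := (SimpleGraph.map_adj _ _ _ _).1 h
    exact y.2 (s.injective hy)
  have hmap : ∀ i j, (T.map s).Adj i j ↔ ((T.induce {ℓ}ᶜ).map (eraseVertex ℓ s)).Adj i j ∨
      ((i = s u ∧ j = s ℓ) ∨ (i = s ℓ ∧ j = s u)) := by
    intro i j
    simp only [SimpleGraph.map_adj]
    constructor
    · rintro ⟨x, y, hxy, rfl, rfl⟩
      by_cases hy : y = ℓ
      · subst hy
        exact .inr (.inl ⟨by rw [huniq x hxy], rfl⟩)
      by_cases hx : x = ℓ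
      · subst hx
        exact .inr (.inr ⟨rfl, by rw [huniq y hxy.symm]⟩)
      exact .inl ⟨⟨x, hx⟩, ⟨y, hy⟩, hxy, rfl, rfl⟩
    · rintro (⟨x, y, hxy, rfl, rfl⟩ | ⟨rfl, rfl⟩ | ⟨rfl, rfl⟩)
      · exact ⟨x, y, hxy, rfl, rfl⟩
      · exact ⟨u, ℓ, hu, rfl, rfl⟩
      · exact ⟨ℓ, u, hu.symm, rfl, rfl⟩
  rw [patternProbBernoulli_eq_prod, patternProbBernoulli_eq_prod, ← hpe₀]
  have hsingle : ∏ e : Fin n × Fin n with e.1 < e.2, (if e = e₀ then p e₀.1 e₀.2 else 1)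
      = p e₀.1 e₀.2 := by
    rw [Finset.prod_ite_eq', if_pos (by simpa using he₀)]
  rw [← hsingle, ← Finset.prod_mul_distrib]
  refine Finset.prod_congr rfl fun e he => ?_
  have he' := hiff e (Finset.mem_filter.1 he).2
  by_cases h : e = e₀
  · have h1 : ¬ ((T.induce {ℓ}ᶜ).map (eraseVertex ℓ s)).Adj e.1 e.2 := by
      rcases he'.1 h with ⟨-, h2⟩ | ⟨h2, -⟩
      · rw [h2]
        exact hnot _
      · rw [h2]
        exact fun h3 => hnot _ h3.symm
    rw [if_pos ((hmap _ _).2 (.inr (he'.1 h))), if_neg h1, if_pos h, one_mul, h]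
  · rw [if_neg h, mul_one]
    have : ¬ ((e.1 = s u ∧ e.2 = s ℓ) ∨ (e.1 = s ℓ ∧ e.2 = s u)) := fun h' => h (he'.2 h')
    exact if_congr ((hmap _ _).trans (or_iff_left this)) rfl rfl

/-- A nontrivial tree has a leaf different from a given vertex, whose removal leaves a tree. -/
theorem exists_leaf [Nontrivial V] {T : SimpleGraph V} (hT : T.IsTree) (x : V) :
    ∃ ℓ u, ℓ ≠ x ∧ T.Adj u ℓ ∧ (∀ v, T.Adj v ℓ → v = u) ∧ (T.induce {ℓ}ᶜ).IsTree := by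
  obtain ⟨a, b, hab, ha, hb⟩ := hT.exists_ne_and_degree_eq_one
  have key : ∀ ℓ, T.degree ℓ = 1 → ℓ ≠ x →
      ∃ ℓ u, ℓ ≠ x ∧ T.Adj u ℓ ∧ (∀ v, T.Adj v ℓ → v = u) ∧ (T.induce {ℓ}ᶜ).IsTree := by
    intro ℓ hℓ hx
    obtain ⟨u, hu, huniq⟩ := SimpleGraph.degree_eq_one_iff_existsUnique_adj.1 hℓ
    exact ⟨ℓ, u, hx, hu.symm, fun v hv => huniq v hv.symm,
      hT.connected.induce_compl_singleton_of_degree_eq_one hℓ, hT.isAcyclic.induce _⟩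
  by_cases h : a = x
  · exact key b hb (h ▸ hab.symm)
  · exact key a ha h

end Patterns

/-- In a graph with degree sequence `D`, the weighted number of copies of a tree rooted at `v` is
at most `D v`. -/
theorem sum_treeWeight_mul_patternIndicator_le {n : ℕ} {D : Fin n → ℕ} (hD : ∀ i, 0 < D i)
    {G : SimpleGraph (Fin n)} (hG : G ∈ graphs D) (v : Fin n) (m : ℕ) :
    ∀ (V : Type) [Fintype V] (T : SimpleGraph V), Fintype.card V = m + 1 → T.IsTree → ∀ x : V,
      ∑ s : V ↪ Fin n with s x = v, treeWeight D s T * patternIndicator s T G ≤ D v := by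
  have hD' : ∀ i, (D i : ℝ) ≠ 0 := fun i => by exact_mod_cast (hD i).ne'
  induction m with
  | zero =>
    intro V _ T hV hT x
    have hsub : Subsingleton V := Fintype.card_le_one_iff_subsingleton.1 hV.le
    have hterm : ∀ s ∈ Finset.univ.filter (fun s : V ↪ Fin n => s x = v),
        treeWeight D s T * patternIndicator s T G ≤ D v := by
      intro s hs
      have hw : treeWeight D s T = D v := by
        unfold treeWeight
        rw [Fintype.prod_subsingleton _ x, (Finset.mem_filter.1 hs).2]
        have : T.degree x = 0 := by
          rw [degree_eq_card_adj, Finset.sum_eq_zero]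
          intro y _
          rw [if_neg]
          exact fun h => h.ne (Subsingleton.elim _ _)
        rw [this]
        simp
      rw [hw]
      unfold patternIndicator
      split_ifs <;> simp
    refine (Finset.sum_le_card_nsmul _ _ _ hterm).trans ?_
    have hcard : (Finset.univ.filter (fun s : V ↪ Fin n => s x = v)).card ≤ 1 := by
      refine Finset.card_le_one.2 fun s hs t ht => ?_
      ext y : 1
      rw [Subsingleton.elim y x, (Finset.mem_filter.1 hs).2, (Finset.mem_filter.1 ht).2]
    rw [nsmul_eq_mul]
    exact mul_le_of_le_one_left (Nat.cast_nonneg _) (by exact_mod_cast hcard)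
  | succ m ih =>
    intro V _ T hV hT x
    have : Nontrivial V := Fintype.one_lt_card_iff_nontrivial.1 (by omega)
    obtain ⟨ℓ, u, hx, hu, huniq, hT'⟩ := exists_leaf hT x
    have hcard : Fintype.card ({ℓ}ᶜ : Set V) = m + 1 := by
      rw [Fintype.card_compl_set]
      simp [hV]
    let x' : ({ℓ}ᶜ : Set V) := ⟨x, hx.symm⟩
    let u' : ({ℓ}ᶜ : Set V) := ⟨u, hu.ne⟩
    let T' := T.induce {ℓ}ᶜ
    let F : (({ℓ}ᶜ : Set V) ↪ Fin n) → Fin n → ℝ := fun s w =>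
      (if s x' = v then treeWeight D s T' * patternIndicator s T' G else 0) *
        ((if G.Adj (s u') w then 1 else 0) / D (s u'))
    have hF0 : ∀ s, 0 ≤ if s x' = v then treeWeight D s T' * patternIndicator s T' G else 0 := by
      intro s
      split_ifs
      · exact mul_nonneg (treeWeight_nonneg _ _ _) (patternIndicator_nonneg _ _ _)
      · exact le_rfl
    have hF : ∀ s w, 0 ≤ F s w := fun s w => by
      refine mul_nonneg (hF0 s) (div_nonneg ?_ (Nat.cast_nonneg _))
      split_ifs <;> norm_num
    calc ∑ s : V ↪ Fin n with s x = v, treeWeight D s T * patternIndicator s T G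
        = ∑ s : V ↪ Fin n, F (eraseVertex ℓ s) (s ℓ) := by
          rw [Finset.sum_filter]
          refine Finset.sum_congr rfl fun s _ => ?_
          have hF' : F (eraseVertex ℓ s) (s ℓ) = (if s x = v then
              treeWeight D (eraseVertex ℓ s) T' * patternIndicator (eraseVertex ℓ s) T' G else 0) *
                ((if G.Adj (s u) (s ℓ) then 1 else 0) / D (s u)) := rfl
          rw [hF', treeWeight_leaf hD hu huniq, patternIndicator_leaf hu huniq]
          by_cases hs : s x = v
          · rw [if_pos hs, if_pos hs, div_mul_eq_mul_div, ← mul_assoc, mul_div_assoc]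
          · rw [if_neg hs, if_neg hs, zero_mul]
      _ ≤ ∑ s, ∑ w, F s w := sum_embedding_le ℓ hF
      _ = ∑ s : ({ℓ}ᶜ : Set V) ↪ Fin n with s x' = v,
            treeWeight D s T' * patternIndicator s T' G := by
          rw [Finset.sum_filter]
          refine Finset.sum_congr rfl fun s _ => ?_
          rw [← Finset.mul_sum, ← Finset.sum_div, sum_adj_eq_degree, mem_graphs.1 hG,
            div_self (hD' _), mul_one]
      _ ≤ D v := ih _ T' hcard hT' x'

/-- Summed over all embeddings, the pattern probabilities of a tree in the two random graphs
are close. -/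
theorem IsMaxEntropy.sum_treeWeight_mul_abs_le {n : ℕ} {D : Fin n → ℕ} {p : Fin n → Fin n → ℝ}
    (hD : IsStrictGraphic D) (hp : IsMaxEntropy D p) (hn : 2 ≤ n) {η : ℝ} (hη : 0 < η)
    (hP : Real.exp (-η * n * Real.log n) ≤ bernoulliProb p (graphs D)) (k : ℕ) (m : ℕ) :
    ∀ (V : Type) [Fintype V] (T : SimpleGraph V), Fintype.card V = m + 1 → m ≤ k → T.IsTree →
      ∑ s : V ↪ Fin n, treeWeight D s T * |patternProbUniform D s T - patternProbBernoulli p s T|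
        ≤ m * ((2 * (η + (k + 1 : ℕ)) + 2) * Real.sqrt (total D * (n * Real.log n))) := by
  have hD' : ∀ i, (D i : ℝ) ≠ 0 := fun i => by exact_mod_cast (hD.pos i).ne'
  have hPpos : 0 < bernoulliProb p (graphs D) := (Real.exp_pos _).trans_le hP
  have hcard0 : ((graphs D).card : ℝ) ≠ 0 := by
    intro h
    rw [hp.bernoulliProb_graphs hD, h] at hPpos
    simp at hPpos
  set Δ := (2 * (η + (k + 1 : ℕ)) + 2) * Real.sqrt (total D * (n * Real.log n))
  induction m with
  | zero =>
    intro V _ T hV _ hT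
    have hsub : Subsingleton V := Fintype.card_le_one_iff_subsingleton.1 hV.le
    have hno : ∀ a b, ¬ T.Adj a b := fun a b h => h.ne (Subsingleton.elim _ _)
    refine le_of_eq ?_
    rw [Nat.cast_zero, zero_mul]
    refine Finset.sum_eq_zero fun s _ => ?_
    have h1 : patternProbUniform D s T = 1 := by
      simp [patternProbUniform, patternIndicator, hno, hcard0]
    have h2 : patternProbBernoulli p s T = 1 := by
      rw [patternProbBernoulli_eq_prod]
      refine Finset.prod_eq_one fun e _ => if_neg fun h => ?_
      obtain ⟨a, b, hab, -⟩ := (SimpleGraph.map_adj _ _ _ _).1 h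
      exact hno a b hab
    rw [h1, h2, sub_self, abs_zero, mul_zero]
  | succ m ih =>
    intro V _ T hV hm hT
    have : Nontrivial V := Fintype.one_lt_card_iff_nontrivial.1 (by omega)
    obtain ⟨ℓ, u, -, hu, huniq, hT'⟩ := exists_leaf hT (Classical.arbitrary V)
    have hcard : Fintype.card ({ℓ}ᶜ : Set V) = m + 1 := by
      rw [Fintype.card_compl_set]
      simp [hV]
    let u' : ({ℓ}ᶜ : Set V) := ⟨u, hu.ne⟩
    let T' := T.induce {ℓ}ᶜ
    let W : (({ℓ}ᶜ : Set V) ↪ Fin n) → SimpleGraph (Fin n) → ℝ := fun s G =>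
      treeWeight D s T' / D (s u') * patternIndicator s T' G
    have hw0 : ∀ s : ({ℓ}ᶜ : Set V) ↪ Fin n, 0 ≤ treeWeight D s T' / D (s u') := fun s =>
      div_nonneg (treeWeight_nonneg _ _ _) (Nat.cast_nonneg _)
    let A : (({ℓ}ᶜ : Set V) ↪ Fin n) → Fin n → ℝ := fun s w =>
      |(∑ G ∈ graphs D, W s G * ((if G.Adj (s u') w then 1 else 0) - p (s u') w))
        / (graphs D).card|
    let B : (({ℓ}ᶜ : Set V) ↪ Fin n) → Fin n → ℝ := fun s w =>
      treeWeight D s T' * |patternProbUniform D s T' - patternProbBernoulli p s T'| *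
        (p (s u') w / D (s u'))
    have hA : ∀ s w, 0 ≤ A s w := fun s w => abs_nonneg _
    have hB : ∀ s w, 0 ≤ B s w := fun s w =>
      mul_nonneg (mul_nonneg (treeWeight_nonneg _ _ _) (abs_nonneg _))
        (div_nonneg (hp.1.nonneg _ _) (Nat.cast_nonneg _))
    have hterm : ∀ s : V ↪ Fin n,
        treeWeight D s T * |patternProbUniform D s T - patternProbBernoulli p s T|
          ≤ A (eraseVertex ℓ s) (s ℓ) + B (eraseVertex ℓ s) (s ℓ) := by
      intro s
      set s' := eraseVertex ℓ s
      have hs' : s u = s' u' := rfl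
      have hsplit : patternProbUniform D s T - patternProbBernoulli p s T
          = (∑ G ∈ graphs D, patternIndicator s' T' G *
              ((if G.Adj (s' u') (s ℓ) then 1 else 0) - p (s' u') (s ℓ))) / (graphs D).card
            + (patternProbUniform D s' T' - patternProbBernoulli p s' T') * p (s' u') (s ℓ) := by
        rw [patternProbBernoulli_leaf hp.1.symm hu huniq]
        unfold patternProbUniform
        simp_rw [patternIndicator_leaf hu huniq s, mul_sub, Finset.sum_sub_distrib,
          ← Finset.sum_mul, ← hs']
        ring
      have hAeq : A s' (s ℓ) = treeWeight D s' T' / D (s' u') *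
          |(∑ G ∈ graphs D, patternIndicator s' T' G *
              ((if G.Adj (s' u') (s ℓ) then 1 else 0) - p (s' u') (s ℓ))) / (graphs D).card| := by
        simp only [A, W]
        rw [← abs_of_nonneg (hw0 s'), ← abs_mul, abs_of_nonneg (hw0 s'), ← mul_div_assoc,
          Finset.mul_sum]
        simp_rw [mul_assoc]
      have hBeq : B s' (s ℓ) = treeWeight D s' T' / D (s' u') *
          |(patternProbUniform D s' T' - patternProbBernoulli p s' T') * p (s' u') (s ℓ)| := by
        simp only [B]
        rw [abs_mul, abs_of_nonneg (hp.1.nonneg _ _)]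
        ring
      rw [hAeq, hBeq, hsplit, treeWeight_leaf hD.pos hu huniq, ← mul_add, hs']
      exact mul_le_mul_of_nonneg_left (abs_add_le _ _) (hw0 s')
    have hI : Fintype.card (({ℓ}ᶜ : Set V) ↪ Fin n) + 1 ≤ n ^ (k + 1) := by
      have h1 : Fintype.card (({ℓ}ᶜ : Set V) ↪ Fin n) ≤ n ^ (m + 1) := by
        refine (Fintype.card_le_of_injective _ DFunLike.coe_injective).trans ?_
        simp [hcard]
      have h2 : n ^ (m + 1) ≤ n ^ k := Nat.pow_le_pow_right (by omega) hm
      have h3 : 1 ≤ n ^ k := Nat.one_le_pow _ _ (by omega)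
      have h4 : n ^ k * 2 ≤ n ^ k * n := Nat.mul_le_mul_left _ hn
      rw [pow_succ]
      omega
    have hAsum : ∑ s, ∑ w, A s w ≤ Δ := by
      refine hp.sum_abs_edge_deviation_le hD hn hη hP hI (fun s => s u') (W := W)
        (fun s G => mul_nonneg (hw0 s) (patternIndicator_nonneg _ _ _)) fun G hG v => ?_
      have h1 := sum_treeWeight_mul_patternIndicator_le hD.pos hG v m _ T' hcard hT' u'
      have h2 : ∑ s with s u' = v, W s G = (∑ s : ({ℓ}ᶜ : Set V) ↪ Fin n with s u' = v,
          treeWeight D s T' * patternIndicator s T' G) / D v := by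
        rw [Finset.sum_div]
        refine Finset.sum_congr rfl fun s hs => ?_
        simp only [W]
        rw [(Finset.mem_filter.1 hs).2]
        ring
      rw [h2]
      exact div_le_one_of_le₀ h1 (Nat.cast_nonneg _)
    have hBsum : ∑ s, ∑ w, B s w ≤ m * Δ := by
      refine le_trans (le_of_eq ?_) (ih _ T' hcard (by omega) hT')
      refine Finset.sum_congr rfl fun s _ => ?_
      rw [← Finset.mul_sum, ← Finset.sum_div, hp.1.row_sum, div_self (hD' _), mul_one]
    calc _ ≤ ∑ s : V ↪ Fin n, (A (eraseVertex ℓ s) (s ℓ) + B (eraseVertex ℓ s) (s ℓ)) :=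
          Finset.sum_le_sum fun s _ => hterm s
      _ ≤ ∑ s, ∑ w, (A s w + B s w) :=
          sum_embedding_le ℓ (F := fun s w => A s w + B s w)
            fun s w => add_nonneg (hA s w) (hB s w)
      _ ≤ Δ + m * Δ := by
          simp_rw [Finset.sum_add_distrib]
          exact add_le_add hAsum hBsum
      _ = _ := by
          push_cast
          ring

theorem IsStrictGraphic.eq_zero_or_two_le {n : ℕ} {D : Fin n → ℕ} (hD : IsStrictGraphic D) :
    n = 0 ∨ 2 ≤ n := by
  rcases Nat.lt_or_ge n 2 with h | h
  · interval_cases n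
    · exact .inl rfl
    · have := hD.strictEG 1 le_rfl le_rfl
      simp at this
  · exact .inr h

theorem exists_discrepancy_le (k : ℕ) (η : ℝ) (hη : 0 < η) : ∃ c : ℝ, 0 < c ∧
    ∀ (n : ℕ) (D : Fin n → ℕ) (p : Fin n → Fin n → ℝ), IsStrictGraphic D → IsMaxEntropy D p →
      Real.exp (-η * n * Real.log n) ≤ bernoulliProb p (graphs D) →
        discrepancy k D p ≤ c * Real.sqrt (n * Real.log n / total D) := by
  set N : ℕ := (Finset.univ.filter fun T : SimpleGraph (Fin k) => T.IsTree).card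
  set K : ℝ := 2 * (η + (k + 1 : ℕ)) + 2
  have hK : 0 < K := by positivity
  refine ⟨N * (k * K) + 1, by positivity, fun n D p hD hp hP => ?_⟩
  have hsqrt := Real.sqrt_nonneg (n * Real.log n / total D)
  rcases hD.eq_zero_or_two_le with rfl | hn
  · have : (total D : ℝ) = 0 := by simp [total]
    simp [discrepancy, this]
  have hMpos : (0 : ℝ) < total D := by
    have : 0 < total D := Finset.sum_pos (fun i _ => hD.pos i) ⟨⟨0, by omega⟩, Finset.mem_univ _⟩
    exact_mod_cast this
  have htree : ∀ T ∈ Finset.univ.filter (fun T : SimpleGraph (Fin k) => T.IsTree),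
      ∑ s : Fin k ↪ Fin n, 1 / bFunction D s T * |treeProbUniform D s T - treeProbBernoulli p s T|
        ≤ k * (K * Real.sqrt (total D * (n * Real.log n))) := by
    intro T hT
    have hT : T.IsTree := (Finset.mem_filter.1 hT).2
    obtain ⟨m, rfl⟩ : ∃ m, k = m + 1 := by
      obtain ⟨x⟩ := hT.connected.nonempty
      exact ⟨k - 1, by have := x.2; omega⟩
    have hb : ∀ s : Fin (m + 1) ↪ Fin n, 1 / bFunction D s T = treeWeight D s T := fun s => by
      unfold bFunction treeWeight
      congr!
    have hind : ∀ (s : Fin (m + 1) ↪ Fin n) G, treeIndicator s T G = patternIndicator s T G :=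
      fun s G => by
        unfold treeIndicator patternIndicator
        congr!
    have hprob : ∀ s : Fin (m + 1) ↪ Fin n,
        |treeProbUniform D s T - treeProbBernoulli p s T|
          = |patternProbUniform D s T - patternProbBernoulli p s T| := fun s => by
      simp only [treeProbUniform, treeProbBernoulli, patternProbUniform, patternProbBernoulli,
        hind]
    simp_rw [hb, hprob]
    refine le_trans ?_ ((hp.sum_treeWeight_mul_abs_le hD hn hη hP (m + 1) m (Fin (m + 1)) T (by simp)
      (by omega) hT).trans ?_)
    · exact le_of_eq (by congr!)
    refine mul_le_mul_of_nonneg_right ?_ (mul_nonneg hK.le (Real.sqrt_nonneg _))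
    push_cast
    linarith
  have hs : 1 / (total D : ℝ) * Real.sqrt (total D * (n * Real.log n))
      = Real.sqrt (n * Real.log n / total D) := by
    rw [show (n : ℝ) * Real.log n / total D = total D * (n * Real.log n) / (total D : ℝ) ^ 2 by
      field_simp, Real.sqrt_div' _ (sq_nonneg _), Real.sqrt_sq hMpos.le]
    ring
  calc discrepancy k D p
      ≤ 1 / (total D : ℝ) * (N * (k * (K * Real.sqrt (total D * (n * Real.log n))))) := by
        unfold discrepancy
        rw [Finset.sum_comm]
        refine mul_le_mul_of_nonneg_left ?_ (by positivity)
        rw [← nsmul_eq_mul]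
        exact Finset.sum_le_card_nsmul _ _ _ htree
    _ = N * (k * K) * Real.sqrt (n * Real.log n / total D) := by
        rw [← hs]
        ring
    _ ≤ _ := mul_le_mul_of_nonneg_right (by linarith) hsqrt

end DegSeq

end

theorem mainTheorem10 :
    -- conditioned on having degree sequence `D`, the max-entropy graph is uniform
    (∀ (n : ℕ) (D : Fin n → ℕ) (p : Fin n → Fin n → ℝ),
      DegSeq.IsStrictGraphic D → DegSeq.IsMaxEntropy D p →
        ∀ G ∈ DegSeq.graphs D,
          0 < DegSeq.bernoulliProb p (DegSeq.graphs D) ∧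
          DegSeq.bernoulliMass p G / DegSeq.bernoulliProb p (DegSeq.graphs D) =
            1 / ((DegSeq.graphs D).card : ℝ)) ∧
    -- the lower bound for a single `D` gives the discrepancy bound for that `D`
    (∀ (k : ℕ) (η : ℝ), 0 < η → ∃ c : ℝ, 0 < c ∧
      ∀ (ε : ℝ), 0 < ε → ∀ (n : ℕ) (D : Fin n → ℕ) (p : Fin n → Fin n → ℝ),
        DegSeq.IsStrictGraphicOfType ε D → DegSeq.IsMaxEntropy D p →
          Real.exp (-η * n * Real.log n) ≤ DegSeq.bernoulliProb p (DegSeq.graphs D) →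
            DegSeq.discrepancy k D p ≤
              c * Real.sqrt (n * Real.log n / DegSeq.total D)) ∧
    -- the first conjecture implies the second
    (∀ ε : ℝ, 0 < ε → DegSeq.LowerBoundConjecture ε → DegSeq.DiscrepancyConjecture ε) := by
  refine ⟨fun n D p hD hp G hG => ?_, fun k η hη => ?_, fun ε _ ⟨η, hη, hbound⟩ k => ?_⟩
  · have hcard : (0 : ℝ) < (DegSeq.graphs D).card := by
      exact_mod_cast Finset.card_pos.2 ⟨G, hG⟩
    rw [hp.bernoulliProb_graphs hD, hp.bernoulliMass_eq hD hG]
    refine ⟨mul_pos hcard (Real.exp_pos _), ?_⟩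
    have := (Real.exp_pos (-DegSeq.entropy p)).ne'
    field_simp
  · obtain ⟨c, hc, h⟩ := DegSeq.exists_discrepancy_le k η hη
    exact ⟨c, hc, fun ε _ n D p hD hp hP => h n D p hD.toIsStrictGraphic hp hP⟩
  · obtain ⟨c, hc, h⟩ := DegSeq.exists_discrepancy_le k η hη
    refine ⟨c, hc, fun n D p hD hp => h n D p hD.toIsStrictGraphic hp ?_⟩
    rw [hp.bernoulliProb_graphs hD.toIsStrictGraphic, Real.exp_neg, ← div_eq_mul_inv,
      le_div_iff₀ (Real.exp_pos _)]
    exact (hbound n D p hD hp).1
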